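/- **Setting.** Let $n,m$ be integers with $m\ge 1$ and let $N=2n+1$, $2n$, $2n+2$ in Lie type $B$, $C$, $D$ respectively, with $2m\le N$. Let $\omega$ be a bilinear form on $\mathbb C^N$, skew-symmetric in type $C$ and symmetric in types $B,D$, and let $e_1,\dots,e_N$ be a basis of $\mathbb C^N$ with $\omega(e_i,e_j)=\delta_{i+j,N+1}$ for $1\le i\le j\le N$ (so $\omega$ is nondegenerate); let $x_1,\dots,x_N$ be the dual basis. Let $X=IG_\omega(m,\mathbb C^N)$ be the variety of isotropic $m$-planes, and let $E_j=\langle e_1,\dots,e_j\rangle$ and $E^{op}_j=\langle e_{N+1-j},\dots,e_N\rangle$, except that $E^{op}_{n+1}=\langle e_{n+1},e_{n+3},\dots,e_N\rangle$ in type $D$ with $n$ even. A *Schubert symbol* is a set $P=\{p_1<\dots<p_m\}\subset[1,N]$ with $c+d\ne N+1$ for all $c,d\in P$. For a flag $F_\bullet$, the Schubert cell $X^\circ_P(F_\bullet)$ is the set of $\Sigma\in X$ with $P=\{c\in[1,N]:\Sigma\cap F_{c-1}\subsetneq\Sigma\cap F_c\}$, and $X_P(F_\bullet)$ is its Zariski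 closure in $X$. Put $X_P=X_P(E_\bullet)$, $X_P^\circ=X_P^\circ(E_\bullet)$, and write $T\preceq P$ if $X_T\subset X_P$. Let $\bar P=\{N+1-c:c\in P\}$, $[P]=P\cup\bar P$. Let $P^\vee=\bar P$, except that in type $D$ with $n$ even $P^\vee$ is obtained from $\bar P$ by interchanging $n+1$ and $n+2$. Let $X^T=X_{T^\vee}(E^{op}_\bullet)$, $Y_{P,T}=X_P\cap X^T$ and $Y^\circ_{P,T}=X^\circ_P\cap X^\circ_{T^\vee}(E^{op}_\bullet)$. Let $\pi$ and $\psi$ be the projections of $\{(L,\Sigma): L\subset\Sigma,\ \dim L=1,\ \Sigma\in X\}$ to $X$ and to $\mathbb P^{N-1}$. **Cuts.** Let $P,T$ be Schubert symbols; put $p_0=t_0=0$, $p_{m+1}=t_{m+1}=N+1$, and $D(P,T)=\{(j,c): t_j\le c\le p_j\}$. An integer $c\in[0,N]$ is a *visible cut* if $p_i\le c<t_{i+1}$ for some $i\in[0,m]$, and an *apparent cut* if $c$ or $N-c$ is a visible cut. In types $B$ and $C$ the *cuts* are the apparent cuts. In type $D$ the cuts are the apparent cuts and the following *exceptional cuts*: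 - $n+1$, if for some $i\in[1,m]$ we have $p_i=n+2\le t_{i+1}$ or $t_i=n+1\ge p_{i-1}$; - $c$ and $N-c$, for each $c\in[1,n]$ with $[c+1,n+1]\subset[P]\cap[T]$ and $\#(T\cap[1,c])=\#(P\cap[1,c])+1$, provided that $\mathfrak t(T)\ne\mathfrak t(P)$. Here $\mathfrak t(P)=2$ if $P\cap\{n+1,n+2\}=\emptyset$, and otherwise $\mathfrak t(P)\in\{0,1\}$ is the parity of $\#([1,n+1]\setminus P)$. An integer $c\in[1,N]$ is a *zero column* if $p_j<c<t_{j+1}$ for some $j\in[0,m]$. An entry $(j,c)\in D(P,T)$ is a *lone star* if $c\in T$ and $c$ is a cut, or $c\in P$ and $c-1$ is a cut. Let $\mathcal L_{P,T}$ be the set of $c\in[1,N]$ such that $c$ is a zero column or there is a lone star in column $N+1-c$. Let $\mathcal Q_{P,T}$ be the set of cuts in $[0,n]$, together with $n+1$ in types $B$ and $D$. Let $f_c=x_1x_N+\dots+x_cx_{N+1-c}$ (so $f_0=0$), except that $f_{n+1}=x_1x_N+\dots+x_nx_{n+2}+\tfrac12x_{n+1}^2$ in type $B$. Let $Z_{P,T}\subset\mathbb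 P^{N-1}$ be the zero locus of $\{f_c: c\in\mathcal Q_{P,T}\}\cup\{x_c:c\in\mathcal L_{P,T}\}$. **Proposition.** Let $T\preceq P$ be Schubert symbols for $X$ of type $B$, $C$ or $D$. 1. For every $\Sigma\in Y_{P,T}$ and every $w\in\Sigma$ we have $f_c(w)=0$ for all $c\in\mathcal Q_{P,T}$ and $x_c(w)=0$ for all $c\in\mathcal L_{P,T}$. 2. Consequently $\psi(\pi^{-1}(Y_{P,T}))\subset Z_{P,T}$. 3. In type $D$, if $c\in[1,n]$ is an exceptional cut in $D(P,T)$, then $f_c(w)=0$ for every vector $w$ lying on a line in $\psi(\pi^{-1}(Y^\circ_{P,T}))$. -/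

import Mathlib

open scoped LinearAlgebra.Projectivization

/-! Isotropic Grassmannians, Richardson varieties, and the equations attached to Richardson diagrams.

Coordinates, flag indices and Schubert symbols are numbered from `1` to `N`, as natural numbers. -/

namespace IsoGrass

/-- The Lie type of the isotropic Grassmannian. -/
inductive LieType
  | B
  | C
  | D

/-- The dimension `N` of the ambient space: `2n+1`, `2n`, `2n+2` in type `B`, `C`, `D`. -/
def ambDim : LieType → ℕ → ℕ
  | .B, n => 2 * n + 1
  | .C, n => 2 * n
  | .D, n => 2 * n + 2

/-- The ambient space `ℂ^N`. -/
abbrev Vec (N : ℕ) := Fin N → ℂ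

/-- The symmetry of the form: skew-symmetric in type `C`, symmetric in types `B` and `D`. -/
def FormSymmetry {N : ℕ} (τ : LieType) (ω : LinearMap.BilinForm ℂ (Vec N)) : Prop :=
  match τ with
  | .C => ∀ v w, ω v w = -ω w v
  | _ => ∀ v w, ω v w = ω w v

section Geometry

variable {N : ℕ}

/-- The basis vector `e_c`, for `1 ≤ c ≤ N` (and `0` for other `c`). -/
noncomputable def bvec (e : Module.Basis (Fin N) ℂ (Vec N)) (c : ℕ) : Vec N :=
  if h : 1 ≤ c ∧ c ≤ N then e ⟨c - 1, by omega⟩ else 0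

/-- The dual basis vector `x_c`, for `1 ≤ c ≤ N` (and `0` for other `c`). -/
noncomputable def coord (e : Module.Basis (Fin N) ℂ (Vec N)) (c : ℕ) : Vec N →ₗ[ℂ] ℂ :=
  if h : 1 ≤ c ∧ c ≤ N then e.coord ⟨c - 1, by omega⟩ else 0

/-- The basis is isotropic: `ω(e_i, e_j) = δ_{i+j,N+1}` for `1 ≤ i ≤ j ≤ N`.
Together with `FormSymmetry` this determines `ω`, and `ω` is nondegenerate. -/
def IsIsotropicBasis (ω : LinearMap.BilinForm ℂ (Vec N)) (e : Module.Basis (Fin N) ℂ (Vec N)) :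
    Prop :=
  ∀ i j : ℕ, 1 ≤ i → i ≤ j → j ≤ N → ω (bvec e i) (bvec e j) = if i + j = N + 1 then 1 else 0

/-- The isotropic Grassmannian `X = IG_ω(m, ℂ^N)`. -/
def isoGr (ω : LinearMap.BilinForm ℂ (Vec N)) (m : ℕ) : Set (Submodule ℂ (Vec N)) :=
  {S | Module.finrank ℂ S = m ∧ ∀ v ∈ S, ∀ w ∈ S, ω v w = 0}

/-- The rows of `A` form a basis of `S`. -/
def IsFrame {m : ℕ} (A : Fin m → Vec N) (S : Submodule ℂ (Vec N)) : Prop :=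
  LinearIndependent ℂ A ∧ Submodule.span ℂ (Set.range A) = S

/-- The closure in `X` of a set `Y` of `m`-planes, for the Zariski topology. The Grassmannian of
`m`-planes carries the quotient topology of the Zariski topology on the `m × N` matrices of
rank `m` under `A ↦ rowspace A` (the quotient by `GL_m`), so `S` lies in the closure of `Y` if and
only if each polynomial in the `m × N` matrix entries that vanishes on all frames of members
of `Y` also vanishes on the frames of `S`. -/
def zariskiClosure (ω : LinearMap.BilinForm ℂ (Vec N)) (m : ℕ) (Y : Set (Submodule ℂ (Vec N))) :
    Set (Submodule ℂ (Vec N)) :=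
  {S | S ∈ isoGr ω m ∧ ∀ F : MvPolynomial (Fin m × Fin N) ℂ,
    (∀ R ∈ Y, ∀ A : Fin m → Vec N, IsFrame A R → MvPolynomial.eval (fun k => A k.1 k.2) F = 0) →
    ∀ A : Fin m → Vec N, IsFrame A S → MvPolynomial.eval (fun k => A k.1 k.2) F = 0}

/-- The standard flag `E_j = ⟨e_1, …, e_j⟩`. -/
noncomputable def stdFlag (e : Module.Basis (Fin N) ℂ (Vec N)) (j : ℕ) : Submodule ℂ (Vec N) :=
  Submodule.span ℂ (bvec e '' Set.Icc 1 j)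

open Classical in
/-- The opposite flag: `E^op_j = ⟨e_{N+1-j}, …, e_N⟩`, except that in type `D` with `n` even
`E^op_{n+1} = ⟨e_{n+1}, e_{n+3}, …, e_N⟩`. -/
noncomputable def oppFlag (τ : LieType) (n : ℕ) (e : Module.Basis (Fin N) ℂ (Vec N)) (j : ℕ) :
    Submodule ℂ (Vec N) :=
  if τ = LieType.D ∧ Even n ∧ j = n + 1 then
    Submodule.span ℂ (bvec e '' insert (n + 1) (Set.Icc (n + 3) N))
  else
    Submodule.span ℂ (bvec e '' Set.Icc (N + 1 - j) N)

/-- Schubert symbols for `IG_ω(m, ℂ^N)`. -/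
def IsSymbol (N m : ℕ) (P : Finset ℕ) : Prop :=
  P ⊆ Finset.Icc 1 N ∧ P.card = m ∧ ∀ c ∈ P, ∀ d ∈ P, c + d ≠ N + 1

/-- The Schubert cell of `P` relative to the flag `F`: the isotropic `m`-planes `S` for which
the steps `c` with `S ∩ F_{c-1} ⊊ S ∩ F_c` are exactly the elements of `P`. -/
def schubertCell (ω : LinearMap.BilinForm ℂ (Vec N)) (m : ℕ) (F : ℕ → Submodule ℂ (Vec N))
    (P : Finset ℕ) : Set (Submodule ℂ (Vec N)) :=
  {S | S ∈ isoGr ω m ∧ ∀ c ∈ Finset.Icc 1 N, c ∈ P ↔ S ⊓ F (c - 1) < S ⊓ F c}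

/-- The Schubert variety of `P` relative to the flag `F`. -/
def schubertVariety (ω : LinearMap.BilinForm ℂ (Vec N)) (m : ℕ) (F : ℕ → Submodule ℂ (Vec N))
    (P : Finset ℕ) : Set (Submodule ℂ (Vec N)) :=
  zariskiClosure ω m (schubertCell ω m F P)

/-- The Bruhat order `T ⪯ P`, that is `X_T ⊆ X_P`. -/
def BruhatLE (ω : LinearMap.BilinForm ℂ (Vec N)) (e : Module.Basis (Fin N) ℂ (Vec N)) (m : ℕ)
    (T P : Finset ℕ) : Prop :=
  schubertVariety ω m (stdFlag e) T ⊆ schubertVariety ω m (stdFlag e) P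

/-- `P̄ = {N+1-c : c ∈ P}`. -/
def bar (N : ℕ) (P : Finset ℕ) : Finset ℕ := P.image fun c => N + 1 - c

open Classical in
/-- The dual symbol `P^∨`: `P̄`, with `n+1` and `n+2` interchanged in type `D` with `n` even. -/
noncomputable def dualSymbol (τ : LieType) (n N : ℕ) (P : Finset ℕ) : Finset ℕ :=
  if τ = LieType.D ∧ Even n then (bar N P).image (Equiv.swap (n + 1) (n + 2)) else bar N P

/-- The Richardson variety `Y_{P,T} = X_P ∩ X^T`, where `X^T = X_{T^∨}(E^op)`. -/
noncomputable def richardson (τ : LieType) (n : ℕ) (ω : LinearMap.BilinForm ℂ (Vec N))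
    (e : Module.Basis (Fin N) ℂ (Vec N)) (m : ℕ) (P T : Finset ℕ) :
    Set (Submodule ℂ (Vec N)) :=
  schubertVariety ω m (stdFlag e) P ∩
    schubertVariety ω m (oppFlag τ n e) (dualSymbol τ n N T)

/-- The open Richardson cell `Y°_{P,T} = X°_P ∩ X°_{T^∨}(E^op)`. -/
noncomputable def openRichardson (τ : LieType) (n : ℕ) (ω : LinearMap.BilinForm ℂ (Vec N))
    (e : Module.Basis (Fin N) ℂ (Vec N)) (m : ℕ) (P T : Finset ℕ) :
    Set (Submodule ℂ (Vec N)) :=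
  schubertCell ω m (stdFlag e) P ∩
    schubertCell ω m (oppFlag τ n e) (dualSymbol τ n N T)

/-- The two-step isotropic flag variety `IF_ω(1, m, ℂ^N)`, as the set of pairs of a
point `L` of `ℙ^{N-1}` and an isotropic `m`-plane containing the line `L`. -/
def isoFlag (ω : LinearMap.BilinForm ℂ (Vec N)) (m : ℕ) :
    Set (ℙ ℂ (Vec N) × Submodule ℂ (Vec N)) :=
  {x | x.2 ∈ isoGr ω m ∧ x.1.submodule ≤ x.2}

/-- `ψ(π⁻¹(Y))`, where `ψ` and `π` are the projections of `IF_ω(1, m, ℂ^N)` to `ℙ^{N-1}` and to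
`IG_ω(m, ℂ^N)`. -/
def projected (ω : LinearMap.BilinForm ℂ (Vec N)) (m : ℕ) (Y : Set (Submodule ℂ (Vec N))) :
    Set (ℙ ℂ (Vec N)) :=
  Prod.fst '' (isoFlag ω m ∩ Prod.snd ⁻¹' Y)

end Geometry

section Diagram

/-- The `i`-th element of `P = {p_1 < ⋯ < p_m}`, with `p_0 = 0` and `p_i = N+1` for `i > m`. -/
def entry (N : ℕ) (P : Finset ℕ) (i : ℕ) : ℕ :=
  if i = 0 then 0 else P.sort.getD (i - 1) (N + 1)

/-- `(j, c)` lies in the Richardson diagram `D(P,T)`. -/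
def InDiagram (N m : ℕ) (P T : Finset ℕ) (j c : ℕ) : Prop :=
  1 ≤ j ∧ j ≤ m ∧ entry N T j ≤ c ∧ c ≤ entry N P j

/-- `c` is a visible cut in `D(P,T)`. -/
def IsVisibleCut (N m : ℕ) (P T : Finset ℕ) (c : ℕ) : Prop :=
  c ≤ N ∧ ∃ i ≤ m, entry N P i ≤ c ∧ c < entry N T (i + 1)

/-- `c` is an apparent cut in `D(P,T)`. -/
def IsApparentCut (N m : ℕ) (P T : Finset ℕ) (c : ℕ) : Prop :=
  c ≤ N ∧ (IsVisibleCut N m P T c ∨ IsVisibleCut N m P T (N - c))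

/-- `c` is a zero column of `D(P,T)`. -/
def IsZeroColumn (N m : ℕ) (P T : Finset ℕ) (c : ℕ) : Prop :=
  1 ≤ c ∧ c ≤ N ∧ ∃ j ≤ m, entry N P j < c ∧ c < entry N T (j + 1)

/-- The type `𝔱(P) ∈ {0, 1, 2}` of a symbol in type `D`. -/
def symbolType (n : ℕ) (P : Finset ℕ) : ℕ :=
  if n + 1 ∈ P ∨ n + 2 ∈ P then (Finset.Icc 1 (n + 1) \ P).card % 2 else 2

/-- `n+1` is an exceptional center cut in `D(P,T)` (type `D`). -/
def HasExceptionalCenterCut (n m : ℕ) (P T : Finset ℕ) : Prop :=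
  ∃ i, 1 ≤ i ∧ i ≤ m ∧
    ((entry (2 * n + 2) P i = n + 2 ∧ n + 2 ≤ entry (2 * n + 2) T (i + 1)) ∨
      (entry (2 * n + 2) T i = n + 1 ∧ entry (2 * n + 2) P (i - 1) ≤ n + 1))

/-- `c ∈ [1,n]` is a cut candidate (type `D`): `[c+1,n+1] ⊆ [P] ∩ [T]`, with `[P] = P ∪ P̄`,
and `#(T ∩ [1,c]) = #(P ∩ [1,c]) + 1`. -/
def IsCutCandidate (n : ℕ) (P T : Finset ℕ) (c : ℕ) : Prop :=
  1 ≤ c ∧ c ≤ n ∧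
    Finset.Icc (c + 1) (n + 1) ⊆ (P ∪ bar (2 * n + 2) P) ∩ (T ∪ bar (2 * n + 2) T) ∧
    (T ∩ Finset.Icc 1 c).card = (P ∩ Finset.Icc 1 c).card + 1

/-- `c` is an exceptional cut in `D(P,T)` (type `D`): the exceptional center cut, or, when
`𝔱(T) ≠ 𝔱(P)`, one of `d` and `N - d` for a cut candidate `d`. -/
def IsExceptionalCut (n m : ℕ) (P T : Finset ℕ) (c : ℕ) : Prop :=
  (c = n + 1 ∧ HasExceptionalCenterCut n m P T) ∨
    (symbolType n T ≠ symbolType n P ∧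
      ∃ d, IsCutCandidate n P T d ∧ (c = d ∨ c = 2 * n + 2 - d))

/-- The set `𝒞_{P,T}` of cuts in `D(P,T)`. -/
def cuts (τ : LieType) (n m : ℕ) (P T : Finset ℕ) : Set ℕ :=
  {c | IsApparentCut (ambDim τ n) m P T c ∨ (τ = LieType.D ∧ IsExceptionalCut n m P T c)}

/-- The entry `(j, c)` is a lone star of `D(P,T)`. -/
def IsLoneStar (τ : LieType) (n m : ℕ) (P T : Finset ℕ) (j c : ℕ) : Prop :=
  InDiagram (ambDim τ n) m P T j c ∧
    ((c ∈ T ∧ c ∈ cuts τ n m P T) ∨ (c ∈ P ∧ c - 1 ∈ cuts τ n m P T))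

/-- The set `ℒ_{P,T}`, indexing the linear equations. -/
def linSet (τ : LieType) (n m : ℕ) (P T : Finset ℕ) : Set ℕ :=
  {c | 1 ≤ c ∧ c ≤ ambDim τ n ∧
    (IsZeroColumn (ambDim τ n) m P T c ∨ ∃ j, IsLoneStar τ n m P T j (ambDim τ n + 1 - c))}

/-- The set `𝒬_{P,T}`, indexing the quadratic equations. -/
def quadSet (τ : LieType) (n m : ℕ) (P T : Finset ℕ) : Set ℕ :=
  {c | (c ≤ n ∧ c ∈ cuts τ n m P T) ∨ (τ ≠ LieType.C ∧ c = n + 1)}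

open Classical in
/-- The quadratic form `f_c = x_1 x_N + ⋯ + x_c x_{N+1-c}`, except that in type `B`
`f_{n+1} = x_1 x_N + ⋯ + x_n x_{n+2} + (1/2) x_{n+1}^2`. -/
noncomputable def quadForm (τ : LieType) (n : ℕ)
    (e : Module.Basis (Fin (ambDim τ n)) ℂ (Vec (ambDim τ n))) (c : ℕ) (w : Vec (ambDim τ n)) : ℂ :=
  if τ = LieType.B ∧ c = n + 1 then
    ∑ i ∈ Finset.Icc 1 n, coord e i w * coord e (ambDim τ n + 1 - i) w +
      (1 / 2) * coord e (n + 1) w ^ 2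
  else
    ∑ i ∈ Finset.Icc 1 c, coord e i w * coord e (ambDim τ n + 1 - i) w

/-- The vector `w` satisfies all the equations `f_c = 0`, `c ∈ 𝒬_{P,T}`, and `x_c = 0`,
`c ∈ ℒ_{P,T}`. -/
def SatisfiesEquations (τ : LieType) (n m : ℕ)
    (e : Module.Basis (Fin (ambDim τ n)) ℂ (Vec (ambDim τ n))) (P T : Finset ℕ)
    (w : Vec (ambDim τ n)) : Prop :=
  (∀ c ∈ quadSet τ n m P T, quadForm τ n e c w = 0) ∧ ∀ c ∈ linSet τ n m P T, coord e c w = 0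

/-- The subvariety `Z_{P,T} ⊆ ℙ^{N-1}`. -/
def zVariety (τ : LieType) (n m : ℕ)
    (e : Module.Basis (Fin (ambDim τ n)) ℂ (Vec (ambDim τ n))) (P T : Finset ℕ) :
    Set (ℙ ℂ (Vec (ambDim τ n))) :=
  {L | ∀ w ∈ L.submodule, SatisfiesEquations τ n m e P T w}

end Diagram

end IsoGrass

open IsoGrass

namespace IsoGrass

open Module

/-! ### Lagrangian subspaces and the parity of their intersections -/

section Lagrangian

variable {K V : Type*} [Field K] [AddCommGroup V] [Module K V]
  [FiniteDimensional K V]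

/-! Write F for the flag of `e`, F' for the flag of `revBasis e`, Q for `bar N T`, and let S be a
point of the Richardson variety. Intersection dimensions are semicontinuous
(`le_finrank_inf_of_mem_zariskiClosure`), so S meets F_c in dimension at least `cnt P c` and F'_d in
dimension at least `cnt Q d`.

At a visible cut c these bounds add up to m, so S is the direct sum of S ∩ F_c and S ∩ F'_{N-c}. If
w = u + v accordingly and 2c ≤ N, then f_c(w) = ω(u, w) = 0; a visible cut at N - c is handled
symmetrically. A zero column c splits S along F_{c-1} and F'_{N-c}, where x_c vanishes. At a lone
star in column c beside a visible cut the bounds exceed m, which forces e_c into S, and ω(e_c, w) =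
0 says x_{N+1-c}(w) = 0. If it is the reflected cut that is visible, column N+1-c satisfies the zero
column inequality instead.

At an exceptional cut in [1, n] the bounds fall one short, and parity supplies the missing
dimension. When S ∩ F_c has its least dimension, the covering condition makes A = F_c + (S ∩ F_c^⊥)
(`hat`) Lagrangian, and P determines which of the two families contains it
(`even_finrank_inf_add_cnt`). A Lagrangian B arises likewise from F'_d and Q. Counting leaves two
consecutive values for dim(A ∩ B), and 𝔱(T) ≠ 𝔱(P) selects the larger (`finrank_hat_inf_hat`). Hence
A ∩ B ⊆ S, or S is the sum of its intersections with F_{N-c} and F'_{N-d}; either alternative gives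
the equations. The exceptional center cut only needs F_{n+1} replaced by the other Lagrangian
between F_n and F_{n+2}. -/

theorem even_finrank_of_isAlt_of_nondegenerate [NeZero (2 : K)]
    {B : LinearMap.BilinForm K V} (hB : B.IsAlt) (hn : B.Nondegenerate) : Even (finrank K V) := by
  classical
  by_contra hodd
  rw [Nat.not_even_iff_odd] at hodd
  let b := finBasis K V
  set M := LinearMap.BilinForm.toMatrix b B with hM
  have hdet : M.det ≠ 0 := (LinearMap.BilinForm.nondegenerate_iff_det_ne_zero b).1 hn
  have hT : M.transpose = -M := by
    ext i j
    simp only [hM, Matrix.transpose_apply, Matrix.neg_apply, LinearMap.BilinForm.toMatrix_apply]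
    exact (hB.neg_eq _ _).symm
  -- A skew-symmetric matrix of odd size has determinant equal to its own negative.
  have h1 : M.det = -M.det := by
    conv_lhs => rw [← Matrix.det_transpose, hT, Matrix.det_neg, Fintype.card_fin, hodd.neg_one_pow]
    ring
  have h2 : (2 : K) * M.det = 0 := by linear_combination h1
  exact hdet ((mul_eq_zero.1 h2).resolve_left two_ne_zero)

/-- The form restricts to a nondegenerate alternating form on any complement of its kernel. -/
theorem even_finrank_sub_finrank_ker [NeZero (2 : K)] {B : LinearMap.BilinForm K V} (hB : B.IsAlt) :
    Even (finrank K V - finrank K (LinearMap.ker B)) := by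
  obtain ⟨U, hU⟩ := (LinearMap.ker B).exists_isCompl
  have hl : (B.domRestrict₁₂ U U).SeparatingLeft := by
    rintro ⟨x, hx⟩ h
    have hk : x ∈ LinearMap.ker B := by
      refine LinearMap.mem_ker.2 (LinearMap.ext fun v => ?_)
      obtain ⟨k, hk, u, hu, rfl⟩ := Submodule.mem_sup.1
        (hU.sup_eq_top.ge (Submodule.mem_top (x := v)))
      have h1 : B x u = 0 := h ⟨u, hu⟩
      have h2 : B x k = 0 := by rw [← hB.neg_eq, LinearMap.mem_ker.1 hk]; simp
      rw [map_add, h1, h2]; simp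
    exact Subtype.ext (Submodule.disjoint_def.1 hU.disjoint x hk hx)
  have hn : (B.domRestrict₁₂ U U).Nondegenerate :=
    ⟨hl, fun y h => hl y fun x => by
      have := hB.neg_eq (x : V) (y : V)
      have h' : B x y = 0 := h x
      rw [h'] at this
      exact (this.symm.trans neg_zero : B y x = 0)⟩
  have := even_finrank_of_isAlt_of_nondegenerate (B := B.domRestrict₁₂ U U)
    (fun x => hB x) hn
  have h := Submodule.finrank_add_eq_of_isCompl hU
  rwa [← h, Nat.add_sub_cancel_left]

/-- `L` is isotropic of half the dimension. -/
def IsLagrangian (B : LinearMap.BilinForm K V) (L : Submodule K V) : Prop :=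
  (∀ x ∈ L, ∀ y ∈ L, B x y = 0) ∧ 2 * finrank K L = finrank K V

variable {B : LinearMap.BilinForm K V}

theorem two_mul_finrank_le_of_isotropic (hn : B.Nondegenerate) {L : Submodule K V}
    (hL : ∀ x ∈ L, ∀ y ∈ L, B x y = 0) : 2 * finrank K L ≤ finrank K V := by
  have h1 : L ≤ B.orthogonal L := fun x hx y hy => hL y hy x hx
  have h2 := Submodule.finrank_mono h1
  rw [LinearMap.BilinForm.finrank_orthogonal hn] at h2
  have := L.finrank_le
  omega

theorem IsLagrangian.orthogonal_eq (hn : B.Nondegenerate) {L : Submodule K V}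
    (hL : IsLagrangian B L) : B.orthogonal L = L := by
  symm
  have h : L ≤ B.orthogonal L := fun x hx y hy => hL.1 y hy x hx
  apply Submodule.eq_of_le_of_finrank_le h
  rw [LinearMap.BilinForm.finrank_orthogonal hn]
  have := hL.2
  omega

theorem IsLagrangian.mem_of_forall (hn : B.Nondegenerate) {L : Submodule K V}
    (hL : IsLagrangian B L) {x : V} (hx : ∀ y ∈ L, B y x = 0) : x ∈ L := by
  rw [← hL.orthogonal_eq hn]
  exact hx

theorem orthogonal_sup {K V : Type*} [Field K] [AddCommGroup V] [Module K V]
    {B : LinearMap.BilinForm K V} (U W : Submodule K V) :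
    B.orthogonal (U ⊔ W) = B.orthogonal U ⊓ B.orthogonal W := by
  apply le_antisymm
  · exact le_inf (LinearMap.BilinForm.orthogonal_le le_sup_left)
      (LinearMap.BilinForm.orthogonal_le le_sup_right)
  · rintro x ⟨h1, h2⟩ y hy
    obtain ⟨u, hu, w, hw, rfl⟩ := Submodule.mem_sup.1 hy
    have a : B u x = 0 := h1 u hu
    have b : B w x = 0 := h2 w hw
    rw [map_add, LinearMap.add_apply, a, b, add_zero]

theorem orthogonal_inf (hn : B.Nondegenerate) (hr : B.IsRefl) (U W : Submodule K V) :
    B.orthogonal (U ⊓ W) = B.orthogonal U ⊔ B.orthogonal W := by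
  rw [← LinearMap.BilinForm.orthogonal_orthogonal hn hr (B.orthogonal U ⊔ B.orthogonal W),
    orthogonal_sup, LinearMap.BilinForm.orthogonal_orthogonal hn hr,
    LinearMap.BilinForm.orthogonal_orthogonal hn hr]

/-- Two Lagrangian subspaces of a nondegenerate symmetric form lie in the same family if and only
if their intersection has codimension of even parity; this relation is transitive. -/
theorem IsLagrangian.even_add [NeZero (2 : K)] (hn : B.Nondegenerate) (hs : ∀ x y, B x y = B y x)
    {L L₀ L₁ : Submodule K V} (hL : IsLagrangian B L) (h₀ : IsLagrangian B L₀)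
    (h₁ : IsLagrangian B L₁) :
    Even (finrank K L + finrank K ↥(L ⊓ L₀) + finrank K ↥(L ⊓ L₁) + finrank K ↥(L₀ ⊓ L₁)) := by
  have hr : B.IsRefl := fun x y h => by rw [hs, h]
  -- φ chooses an `L₀`-component linearly; the choice is ambiguous up to L₀ ∩ L₁.
  obtain ⟨φ, hφ⟩ : ∃ φ : ↥(L₀ ⊔ L₁) →ₗ[K] V,
      ∀ x, φ x ∈ L₀ ∧ (x : V) - φ x ∈ L₁ := by
    let f : (L₀ × L₁) →ₗ[K] ↥(L₀ ⊔ L₁) :=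
      (Submodule.inclusion le_sup_left).coprod (Submodule.inclusion le_sup_right)
    have hf : LinearMap.range f = ⊤ := by
      rw [LinearMap.range_eq_top]
      rintro ⟨x, hx⟩
      obtain ⟨u, hu, w, hw, rfl⟩ := Submodule.mem_sup.1 hx
      exact ⟨(⟨u, hu⟩, ⟨w, hw⟩), rfl⟩
    obtain ⟨g, hg⟩ := f.exists_rightInverse_of_surjective hf
    refine ⟨L₀.subtype ∘ₗ LinearMap.fst K L₀ L₁ ∘ₗ g, fun x => ⟨(g x).1.2, ?_⟩⟩
    have h := congrArg Subtype.val (LinearMap.congr_fun hg x)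
    have h' : ((g x).1 : V) + ((g x).2 : V) = x := h
    have : (x : V) - (g x).1 = (g x).2 := by rw [← h']; abel
    simp [this]
  set U := L ⊓ (L₀ ⊔ L₁) with hU
  let ψ : U →ₗ[K] V := φ ∘ₗ Submodule.inclusion inf_le_right
  have hψ0 : ∀ x : U, ψ x ∈ L₀ := fun x => (hφ _).1
  have hψ1 : ∀ x : U, (x : V) - ψ x ∈ L₁ := fun x => (hφ (Submodule.inclusion inf_le_right x)).2
  -- This form is alternating on L ∩ (L₀ + L₁) with kernel (L ∩ L₀) + (L ∩ L₁); the evenness of its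
  -- rank is the claim.
  let b : LinearMap.BilinForm K U := B.compl₁₂ ψ U.subtype
  have hbv : ∀ x y : U, b x y = B (ψ x) y := fun x y => rfl
  have halt : b.IsAlt := by
    intro x
    rw [hbv]
    obtain ⟨z, hz⟩ : ∃ z, z = (x : V) - ψ x := ⟨_, rfl⟩
    have hz1 : z ∈ L₁ := hz ▸ hψ1 x
    have hx : (x : V) = ψ x + z := by rw [hz]; abel
    have e1 := hL.1 x x.2.1 x x.2.1
    have e2 := h₀.1 _ (hψ0 x) _ (hψ0 x)
    have e3 := h₁.1 z hz1 z hz1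
    rw [hx] at e1 ⊢
    simp only [map_add, LinearMap.add_apply] at e1 ⊢
    rw [hs z (ψ x)] at e1
    have : (2 : K) * B (ψ x) z = 0 := by linear_combination e1 - e2 - e3
    rw [e2, (mul_eq_zero.1 this).resolve_left two_ne_zero, add_zero]
  have hUo : U = B.orthogonal (L ⊔ (L₀ ⊓ L₁)) := by
    rw [orthogonal_sup, orthogonal_inf hn hr, hL.orthogonal_eq hn, h₀.orthogonal_eq hn,
      h₁.orthogonal_eq hn]
  have hker : (LinearMap.ker b).map U.subtype = (L ⊓ L₀) ⊔ (L ⊓ L₁) := by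
    apply le_antisymm
    · rintro _ ⟨x, hx, rfl⟩
      have hx' : ψ x ∈ B.orthogonal U := by
        intro y hy
        have := LinearMap.congr_fun (LinearMap.mem_ker.1 hx) ⟨y, hy⟩
        rw [hbv] at this
        rw [hs]
        exact this
      have hx' : ψ x ∈ L ⊔ L₀ ⊓ L₁ := by
        rw [← LinearMap.BilinForm.orthogonal_orthogonal hn hr (L ⊔ L₀ ⊓ L₁), ← hUo]
        exact hx'
      obtain ⟨l, hl, t, ht, hlt⟩ := Submodule.mem_sup.1 hx'
      have hl0 : l ∈ L₀ := by
        have : l = ψ x - t := by rw [← hlt]; abel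
        rw [this]; exact L₀.sub_mem (hψ0 x) ht.1
      refine Submodule.mem_sup.2 ⟨l, ⟨hl, hl0⟩, x - l, ⟨L.sub_mem x.2.1 hl, ?_⟩, by simp⟩
      have : (x : V) - l = (x - ψ x) + t := by rw [← hlt]; abel
      rw [this]
      exact L₁.add_mem (hψ1 x) ht.2
    · have key : ∀ x (hx : x ∈ U), (∀ y ∈ U, B (ψ ⟨x, hx⟩) y = 0) →
          x ∈ (LinearMap.ker b).map U.subtype := fun x hx h =>
        ⟨⟨x, hx⟩, LinearMap.mem_ker.2 (LinearMap.ext fun y => h y y.2), rfl⟩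
      -- The ambiguity in φ is orthogonal to U, so it does not affect b.
      have kinf : ∀ t ∈ L₀ ⊓ L₁, ∀ y ∈ U, B t y = 0 := by
        rintro t ⟨t0, t1⟩ y ⟨-, hy⟩
        obtain ⟨u, hu, w, hw, rfl⟩ := Submodule.mem_sup.1 hy
        rw [map_add, h₀.1 t t0 u hu, h₁.1 t t1 w hw, add_zero]
      apply sup_le
      · rintro x ⟨hx, hx0⟩
        have hxU : x ∈ U := ⟨hx, Submodule.mem_sup_left hx0⟩
        refine key x hxU fun y hy => ?_
        have h1 : x - ψ ⟨x, hxU⟩ ∈ L₀ ⊓ L₁ := ⟨L₀.sub_mem hx0 (hψ0 _), hψ1 ⟨x, hxU⟩⟩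
        have h2 := kinf _ h1 y hy
        rw [map_sub, LinearMap.sub_apply, hL.1 x hx y hy.1] at h2
        simpa using h2
      · rintro x ⟨hx, hx1⟩
        have hxU : x ∈ U := ⟨hx, Submodule.mem_sup_right hx1⟩
        refine key x hxU fun y hy => kinf _ ⟨hψ0 _, ?_⟩ y hy
        have := L₁.sub_mem hx1 (hψ1 ⟨x, hxU⟩)
        simpa using this
  have hev := even_finrank_sub_finrank_ker halt
  have hle := (LinearMap.ker b).finrank_le
  rw [← Submodule.finrank_map_subtype_eq, hker] at hev hle
  have c1 := Submodule.finrank_sup_add_finrank_inf_eq (L ⊓ L₀) (L ⊓ L₁)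
  have c2 := Submodule.finrank_sup_add_finrank_inf_eq L (L₀ ⊓ L₁)
  have c3 : (L ⊓ L₀) ⊓ (L ⊓ L₁) = L ⊓ (L₀ ⊓ L₁) := inf_inf_distrib_left L L₀ L₁ |>.symm
  rw [c3] at c1
  have c4 : finrank K U = finrank K V - finrank K ↥(L ⊔ L₀ ⊓ L₁) := by
    rw [← LinearMap.BilinForm.finrank_orthogonal hn, ← hUo]
  have c5 := (L ⊔ L₀ ⊓ L₁).finrank_le
  have c6 := hL.2
  grind

/-- Every Lagrangian subspace has a Lagrangian complement, given one pair of transversal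
Lagrangian subspaces. -/
theorem IsLagrangian.exists_disjoint (hn : B.Nondegenerate) (hs : ∀ x y, B x y = B y x)
    {L E F : Submodule K V} (hL : IsLagrangian B L) (hE : IsLagrangian B E)
    (hF : IsLagrangian B F) (hEF : E ⊓ F = ⊥) : ∃ M, IsLagrangian B M ∧ L ⊓ M = ⊥ := by
  -- The complement of L will be G + (G^⊥ ∩ F), where G is a complement of L ∩ E in E.
  obtain ⟨K', hK⟩ := ((L ⊓ E).submoduleOf E).exists_isCompl
  obtain ⟨G, hG⟩ : ∃ G, G = K'.map E.subtype := ⟨_, rfl⟩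
  have hGE : G ≤ E := hG ▸ Submodule.map_subtype_le E K'
  have hGL : ∀ x ∈ G, x ∈ L → x = 0 := by
    rintro x hx hxL
    rw [hG] at hx
    obtain ⟨y, hy, rfl⟩ := hx
    have := Submodule.disjoint_def.1 hK.disjoint y ⟨hxL, y.2⟩ hy
    rw [this]; simp
  have hsup : ∀ x ∈ E, ∃ a ∈ L ⊓ E, ∃ b ∈ G, a + b = x := by
    intro x hx
    obtain ⟨a, ha, b, hb, hab⟩ := Submodule.mem_sup.1
      (hK.sup_eq_top.ge (Submodule.mem_top (x := (⟨x, hx⟩ : E))))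
    exact ⟨a, ha, b, hG ▸ ⟨b, hb, rfl⟩, congrArg Subtype.val hab⟩
  obtain ⟨H, hH⟩ : ∃ H, H = B.orthogonal (G ⊔ F) := ⟨_, rfl⟩
  have hHF : H ≤ F := by
    rw [hH, orthogonal_sup, hF.orthogonal_eq hn]
    exact inf_le_right
  have hHG : ∀ g ∈ G, ∀ h ∈ H, B g h = 0 := fun g hg h hh => by
    rw [hH] at hh
    exact hh g (Submodule.mem_sup_left hg)
  refine ⟨G ⊔ H, ⟨?_, ?_⟩, ?_⟩
  · intro x hx y hy
    obtain ⟨a, ha, b, hb, rfl⟩ := Submodule.mem_sup.1 hx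
    obtain ⟨c, hc, d, hd, rfl⟩ := Submodule.mem_sup.1 hy
    simp only [map_add, LinearMap.add_apply]
    rw [hE.1 a (hGE ha) c (hGE hc), hHG a ha d hd, hs b c, hHG c hc b hb,
      hF.1 b (hHF hb) d (hHF hd)]
    simp
  · have c1 := Submodule.finrank_sup_add_finrank_inf_eq G H
    have c2 := Submodule.finrank_sup_add_finrank_inf_eq G F
    have e1 : G ⊓ F = ⊥ := by
      rw [eq_bot_iff, ← hEF]
      exact inf_le_inf_right F hGE
    have e2 : G ⊓ H = ⊥ := by
      rw [eq_bot_iff, ← e1]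
      exact inf_le_inf_left G hHF
    rw [e2, finrank_bot] at c1
    rw [e1, finrank_bot] at c2
    have c3 : finrank K H = finrank K V - finrank K ↥(G ⊔ F) := by
      rw [hH, LinearMap.BilinForm.finrank_orthogonal hn]
    have c4 := (G ⊔ F).finrank_le
    have := hF.2
    omega
  · rw [eq_bot_iff]
    rintro x ⟨hxL, hx⟩
    obtain ⟨a, ha, b, hb, rfl⟩ := Submodule.mem_sup.1 hx
    -- b is orthogonal to L ∩ E and to G, hence to E; so it lies in E ∩ F = 0.
    have hb0 : b ∈ E := by
      refine hE.mem_of_forall hn fun y hy => ?_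
      obtain ⟨c, hc, d, hd, rfl⟩ := hsup y hy
      have h1 := hL.1 c hc.1 _ hxL
      rw [map_add, hE.1 c hc.2 a (hGE ha), zero_add] at h1
      rw [map_add, LinearMap.add_apply, h1, hHG d hd b hb, add_zero]
    have hb1 : b = 0 := by
      have : b ∈ E ⊓ F := ⟨hb0, hHF hb⟩
      rwa [hEF, Submodule.mem_bot] at this
    subst hb1
    rw [add_zero] at hxL ⊢
    exact hGL a ha hxL

end Lagrangian


/-! ### Coordinates and the two opposite flags -/

section Coordinates

variable {N : ℕ} (e : Basis (Fin N) ℂ (Vec N))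

theorem coord_bvec {i j : ℕ} (hi : 1 ≤ i) (hiN : i ≤ N) (hj : 1 ≤ j) (hjN : j ≤ N) :
    coord e i (bvec e j) = if i = j then 1 else 0 := by
  rw [coord, bvec, dif_pos ⟨hi, hiN⟩, dif_pos ⟨hj, hjN⟩, Basis.coord_apply, Basis.repr_self,
    Finsupp.single_apply]
  simp only [Fin.mk.injEq]
  congr 1
  rw [eq_iff_iff]
  omega

theorem sum_coord_smul_bvec (v : Vec N) :
    ∑ i ∈ Finset.Icc 1 N, coord e i v • bvec e i = v := by
  conv_rhs => rw [← e.sum_repr v]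
  symm
  refine Finset.sum_bij (fun i _ => (i : ℕ) + 1) ?_ ?_ ?_ ?_
  · intro i _
    have := i.2
    simp only [Finset.mem_Icc]
    omega
  · intro i _ j _ h
    exact Fin.ext (by simpa using h)
  · intro i hi
    rw [Finset.mem_Icc] at hi
    exact ⟨⟨i - 1, by omega⟩, Finset.mem_univ _, by simp only; omega⟩
  · intro i _
    have h : 1 ≤ (i : ℕ) + 1 ∧ (i : ℕ) + 1 ≤ N := ⟨by omega, i.2⟩
    simp [coord, bvec]

theorem eq_of_forall_coord {v w : Vec N}
    (h : ∀ i, 1 ≤ i → i ≤ N → coord e i v = coord e i w) : v = w := by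
  rw [← sum_coord_smul_bvec e v, ← sum_coord_smul_bvec e w]
  refine Finset.sum_congr rfl fun i hi => ?_
  rw [Finset.mem_Icc] at hi
  rw [h i hi.1 hi.2]

theorem mem_span_bvec_iff {I : Set ℕ} {v : Vec N} :
    v ∈ Submodule.span ℂ (bvec e '' I) ↔ ∀ i, 1 ≤ i → i ≤ N → i ∉ I → coord e i v = 0 := by
  constructor
  · intro hv i hi hiN hI
    have : Submodule.span ℂ (bvec e '' I) ≤ LinearMap.ker (coord e i) := by
      rw [Submodule.span_le]
      rintro _ ⟨j, hj, rfl⟩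
      rw [SetLike.mem_coe, LinearMap.mem_ker]
      by_cases hjN : 1 ≤ j ∧ j ≤ N
      · rw [coord_bvec e hi hiN hjN.1 hjN.2, if_neg]
        rintro rfl
        exact hI hj
      · rw [bvec, dif_neg hjN, map_zero]
    exact this hv
  · intro h
    rw [← sum_coord_smul_bvec e v]
    refine Submodule.sum_mem _ fun i hi => ?_
    rw [Finset.mem_Icc] at hi
    by_cases hI : i ∈ I
    · exact Submodule.smul_mem _ _ (Submodule.subset_span ⟨i, hI, rfl⟩)
    · rw [h i hi.1 hi.2 hI, zero_smul]
      exact Submodule.zero_mem _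

theorem mem_stdFlag_iff {c : ℕ} {v : Vec N} :
    v ∈ stdFlag e c ↔ ∀ i, c < i → i ≤ N → coord e i v = 0 := by
  rw [stdFlag, mem_span_bvec_iff]
  constructor
  · intro h i hi hiN
    exact h i (by omega) hiN (by simp only [Set.mem_Icc]; omega)
  · intro h i hi hiN hI
    exact h i (by simp only [Set.mem_Icc] at hI; omega) hiN

theorem bvec_mem_stdFlag {i c : ℕ} (hi : 1 ≤ i) (hc : i ≤ c) : bvec e i ∈ stdFlag e c :=
  Submodule.subset_span ⟨i, ⟨hi, hc⟩, rfl⟩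

theorem stdFlag_mono {c d : ℕ} (h : c ≤ d) : stdFlag e c ≤ stdFlag e d :=
  Submodule.span_mono (Set.image_mono (Set.Icc_subset_Icc_right h))

theorem stdFlag_zero : stdFlag e 0 = ⊥ := by
  simp [stdFlag]

theorem stdFlag_self : stdFlag e N = ⊤ := by
  rw [eq_top_iff]
  intro v _
  rw [mem_stdFlag_iff]
  intro i hi hiN
  omega

theorem finrank_le_finrank_inf_ker_add_one {V : Type*} [AddCommGroup V] [Module ℂ V]
    [FiniteDimensional ℂ V] (U : Submodule ℂ V) (φ : V →ₗ[ℂ] ℂ) :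
    finrank ℂ U ≤ finrank ℂ ↥(U ⊓ LinearMap.ker φ) + 1 := by
  have h1 := Submodule.finrank_sup_add_finrank_inf_eq U (LinearMap.ker φ)
  have h2 := φ.finrank_range_add_finrank_ker
  have h3 := (LinearMap.range φ).finrank_le
  rw [finrank_self] at h3
  have h4 := (U ⊔ LinearMap.ker φ).finrank_le
  omega

theorem stdFlag_inf_ker_coord {c : ℕ} :
    stdFlag e (c + 1) ⊓ LinearMap.ker (coord e (c + 1)) = stdFlag e c := by
  ext v
  rw [Submodule.mem_inf, mem_stdFlag_iff, mem_stdFlag_iff, LinearMap.mem_ker]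
  constructor
  · rintro ⟨h1, h2⟩ i hi hiN
    by_cases h : i = c + 1
    · rw [h, h2]
    · exact h1 i (by omega) hiN
  · intro h
    refine ⟨fun i hi hiN => h i (by omega) hiN, ?_⟩
    by_cases hc : c + 1 ≤ N
    · exact h _ (by omega) hc
    · rw [coord, dif_neg (by omega), LinearMap.zero_apply]

theorem finrank_inf_stdFlag_succ_le (S : Submodule ℂ (Vec N)) (c : ℕ) :
    finrank ℂ ↥(S ⊓ stdFlag e (c + 1)) ≤ finrank ℂ ↥(S ⊓ stdFlag e c) + 1 := by
  rw [← stdFlag_inf_ker_coord e (c := c), ← inf_assoc]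
  exact finrank_le_finrank_inf_ker_add_one (S ⊓ stdFlag e (c + 1)) _

theorem finrank_stdFlag {c : ℕ} (hc : c ≤ N) : finrank ℂ (stdFlag e c) = c := by
  have up : ∀ d, finrank ℂ (stdFlag e d) ≤ d := by
    intro d
    induction d with
    | zero => rw [stdFlag_zero, finrank_bot]
    | succ d ih =>
      have := finrank_inf_stdFlag_succ_le e ⊤ d
      rw [top_inf_eq, top_inf_eq] at this
      omega
  -- The lower bound comes from the top: N - c steps of size at most one must reach dimension N.
  have low : ∀ k, finrank ℂ (stdFlag e (c + k)) ≤ finrank ℂ (stdFlag e c) + k := by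
    intro k
    induction k with
    | zero => simp
    | succ k ih =>
      have := finrank_inf_stdFlag_succ_le e ⊤ (c + k)
      rw [top_inf_eq, top_inf_eq] at this
      rw [← add_assoc]
      omega
  have h1 := low (N - c)
  rw [Nat.add_sub_cancel' hc, stdFlag_self, finrank_top, finrank_fin_fun] at h1
  have := up c
  omega

/-- The basis `e_N, …, e_1`. -/
noncomputable def revBasis : Basis (Fin N) ℂ (Vec N) := e.reindex Fin.revPerm

theorem bvec_revBasis {c : ℕ} (h1 : 1 ≤ c) (h2 : c ≤ N) :
    bvec (revBasis e) c = bvec e (N + 1 - c) := by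
  have h3 : 1 ≤ N + 1 - c ∧ N + 1 - c ≤ N := by omega
  rw [bvec, bvec, dif_pos ⟨h1, h2⟩, dif_pos h3, revBasis, Basis.reindex_apply]
  congr 1
  apply Fin.ext
  simp [Fin.revPerm_symm, Fin.revPerm_apply, Fin.val_rev]
  omega

theorem coord_revBasis {c : ℕ} (h1 : 1 ≤ c) (h2 : c ≤ N) :
    coord (revBasis e) c = coord e (N + 1 - c) := by
  have h3 : 1 ≤ N + 1 - c ∧ N + 1 - c ≤ N := by omega
  rw [coord, coord, dif_pos ⟨h1, h2⟩, dif_pos h3]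
  have h : Fin.revPerm.symm (⟨c - 1, by omega⟩ : Fin N) = ⟨N + 1 - c - 1, by omega⟩ := by
    apply Fin.ext
    simp [Fin.revPerm_symm, Fin.revPerm_apply, Fin.val_rev]
    omega
  refine LinearMap.ext fun v => ?_
  rw [revBasis, Basis.coord_apply, Basis.coord_apply, Basis.repr_reindex_apply, h]

theorem revBasis_revBasis : revBasis (revBasis e) = e := by
  ext i
  simp [revBasis]

theorem mem_stdFlag_revBasis_iff {c : ℕ} {v : Vec N} :
    v ∈ stdFlag (revBasis e) c ↔ ∀ i, 1 ≤ i → i + c ≤ N → coord e i v = 0 := by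
  rw [mem_stdFlag_iff]
  constructor
  · intro h i hi hiN
    have := h (N + 1 - i) (by omega) (by omega)
    rwa [coord_revBasis e (by omega) (by omega), show N + 1 - (N + 1 - i) = i by omega] at this
  · intro h i hi hiN
    rw [coord_revBasis e (by omega) (by omega)]
    exact h _ (by omega) (by omega)

theorem stdFlag_inf_stdFlag_revBasis {c d : ℕ} (h : c + d ≤ N) :
    stdFlag e c ⊓ stdFlag (revBasis e) d = ⊥ := by
  rw [eq_bot_iff]
  rintro v ⟨h1, h2⟩
  rw [SetLike.mem_coe, mem_stdFlag_iff] at h1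
  rw [SetLike.mem_coe, mem_stdFlag_revBasis_iff] at h2
  rw [Submodule.mem_bot]
  refine eq_of_forall_coord e fun i hi hiN => ?_
  rw [map_zero]
  by_cases hc : c < i
  · exact h1 i hc hiN
  · exact h2 i hi (by omega)

theorem eq_smul_bvec_of_mem {c : ℕ} (h1 : 1 ≤ c) (h2 : c ≤ N) {v : Vec N}
    (hv : ∀ i, 1 ≤ i → i ≤ N → i ≠ c → coord e i v = 0) : v = coord e c v • bvec e c := by
  refine eq_of_forall_coord e fun i hi hiN => ?_
  rw [map_smul, coord_bvec e hi hiN h1 h2]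
  by_cases h : i = c
  · simp [h]
  · simp [hv i hi hiN h, h]

/-- Since F_c ∩ F'_{N+1-c} is the line through e_c, this turns a dimension excess into membership of
a basis vector. -/
theorem bvec_mem_of_coord {S : Submodule ℂ (Vec N)} {c : ℕ} (h1 : 1 ≤ c) (h2 : c ≤ N)
    {v : Vec N} (hvS : v ∈ S) (hv0 : v ≠ 0)
    (hv : ∀ i, 1 ≤ i → i ≤ N → i ≠ c → coord e i v = 0) : bvec e c ∈ S := by
  have h := eq_smul_bvec_of_mem e h1 h2 hv
  have hne : coord e c v ≠ 0 := fun h0 => hv0 (by rw [h, h0, zero_smul])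
  have : bvec e c = (coord e c v)⁻¹ • v := by
    conv_rhs => rw [h, map_smul, coord_bvec e h1 h2 h1 h2]
    simp [smul_smul, hne]
  rw [this]
  exact S.smul_mem _ hvS

end Coordinates

/-! ### Dimension counts inside a subspace -/

section Dimension

variable {V : Type*} [AddCommGroup V] [Module ℂ V] [FiniteDimensional ℂ V]
  {S U W : Submodule ℂ V}

theorem finrank_add_le_of_inf_eq_bot (hU : U ≤ S) (hW : W ≤ S) (h : U ⊓ W = ⊥) :
    finrank ℂ U + finrank ℂ W ≤ finrank ℂ S := by
  have h1 := Submodule.finrank_sup_add_finrank_inf_eq U W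
  rw [h, finrank_bot] at h1
  have := Submodule.finrank_mono (sup_le hU hW)
  omega

theorem sup_eq_of_finrank (hU : U ≤ S) (hW : W ≤ S)
    (hd : finrank ℂ S + finrank ℂ ↥(U ⊓ W) ≤ finrank ℂ U + finrank ℂ W) : U ⊔ W = S := by
  apply Submodule.eq_of_le_of_finrank_le (sup_le hU hW)
  have h1 := Submodule.finrank_sup_add_finrank_inf_eq U W
  omega

theorem exists_add_of_finrank (hU : U ≤ S) (hW : W ≤ S)
    (hd : finrank ℂ S + finrank ℂ ↥(U ⊓ W) ≤ finrank ℂ U + finrank ℂ W) {w : V} (hw : w ∈ S) :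
    ∃ u ∈ U, ∃ v ∈ W, u + v = w := by
  rw [← sup_eq_of_finrank hU hW hd] at hw
  exact Submodule.mem_sup.1 hw

theorem exists_ne_zero_mem_inf (hU : U ≤ S) (hW : W ≤ S)
    (hd : finrank ℂ S < finrank ℂ U + finrank ℂ W) : ∃ v ∈ U ⊓ W, v ≠ 0 := by
  refine (Submodule.ne_bot_iff _).1 fun h => ?_
  have := finrank_add_le_of_inf_eq_bot hU hW h
  omega

end Dimension

/-! ### Semicontinuity on the Zariski closure -/

section Closure

variable {N m : ℕ} {ω : LinearMap.BilinForm ℂ (Vec N)} {Y : Set (Submodule ℂ (Vec N))}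
  {S : Submodule ℂ (Vec N)}

theorem zariskiClosure_mono {Y' : Set (Submodule ℂ (Vec N))} (h : Y ⊆ Y') :
    zariskiClosure ω m Y ⊆ zariskiClosure ω m Y' := fun _ hS =>
  ⟨hS.1, fun F hF => hS.2 F fun R hR => hF R (h hR)⟩

theorem subset_zariskiClosure (h : Y ⊆ isoGr ω m) : Y ⊆ zariskiClosure ω m Y := fun S hS =>
  ⟨h hS, fun _ hF A hA => hF S hS A hA⟩

theorem IsFrame.finrank_eq {A : Fin m → Vec N} (hA : IsFrame A S) : finrank ℂ S = m := by
  rw [← hA.2, finrank_span_eq_card hA.1, Fintype.card_fin]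

theorem exists_isFrame (h : finrank ℂ S = m) : ∃ A : Fin m → Vec N, IsFrame A S := by
  let b := finBasisOfFinrankEq ℂ S h
  refine ⟨fun i => b i, b.linearIndependent.map' S.subtype (Submodule.ker_subtype S), ?_⟩
  have : (Set.range fun i => (b i : Vec N)) = S.subtype '' Set.range b := by
    rw [← Set.range_comp]; rfl
  rw [this, Submodule.span_image, b.span_eq, Submodule.map_top, Submodule.range_subtype]

/-- Selects the rows of a nonvanishing minor. -/
theorem exists_linearIndependent_comp {V : Type*} [AddCommGroup V] [Module ℂ V]
    [FiniteDimensional ℂ V] (v : Fin m → V) {r : ℕ}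
    (hr : r ≤ finrank ℂ ↥(Submodule.span ℂ (Set.range v))) :
    ∃ k : Fin r → Fin m, LinearIndependent ℂ (v ∘ k) := by
  obtain ⟨t, ht, hspan, hli⟩ := exists_linearIndependent ℂ (Set.range v)
  have hfin : t.Finite := (Set.finite_range v).subset ht
  have := hfin.fintype
  have hcard : r ≤ Fintype.card t := by
    have := finrank_span_eq_card hli
    rw [Subtype.range_coe, hspan] at this
    exact hr.trans (this.le.trans (by rw [Fintype.card_congr (Equiv.refl t)]))
  let f : Fin r ↪ t := (Fin.castLEEmb hcard).trans (Fintype.equivFin t).symm.toEmbedding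
  choose k hk using fun i : Fin r => ht (f i).2
  refine ⟨k, ?_⟩
  have : v ∘ k = (fun x : t => (x : V)) ∘ f := funext hk
  rw [this]
  exact hli.comp f f.injective

/-- Intersecting a fixed subspace in dimension at least `r` is a Zariski closed condition. -/
theorem le_finrank_inf_of_mem_zariskiClosure (V : Submodule ℂ (Vec N)) {r : ℕ}
    (hY : ∀ R ∈ Y, r ≤ finrank ℂ ↥(R ⊓ V)) (hS : S ∈ zariskiClosure ω m Y) :
    r ≤ finrank ℂ ↥(S ⊓ V) := by
  by_contra! hlt
  obtain ⟨A, hA⟩ := exists_isFrame hS.1.1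
  have hquot : ∀ R : Submodule ℂ (Vec N),
      finrank ℂ ↥(R.map V.mkQ) + finrank ℂ ↥(R ⊓ V) = finrank ℂ R := by
    intro R
    have h := (V.mkQ.domRestrict R).finrank_range_add_finrank_ker
    rw [LinearMap.range_domRestrict, LinearMap.ker_domRestrict, Submodule.ker_mkQ] at h
    rw [← h, ← Submodule.finrank_map_subtype_eq R (V.comap R.subtype),
      Submodule.map_comap_subtype]
  have hSm : finrank ℂ S = m := hS.1.1
  have hspan : Submodule.span ℂ (Set.range (V.mkQ ∘ A)) = S.map V.mkQ := by
    rw [Set.range_comp, Submodule.span_image, hA.2]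
  obtain ⟨k, hk⟩ := exists_linearIndependent_comp (V.mkQ ∘ A) 
    (r := finrank ℂ ↥(S.map V.mkQ)) (by rw [hspan])
  -- ψ is normalised so that the chosen minor equals 1 at the frame A of S.
  obtain ⟨ψ, hψ⟩ : ∃ ψ : (Vec N ⧸ V) →ₗ[ℂ] (Fin (finrank ℂ ↥(S.map V.mkQ)) → ℂ),
      ∀ i, ψ (V.mkQ (A (k i))) = Pi.single i 1 := by
    obtain ⟨ψ, hψ⟩ := LinearMap.exists_extend
      (p := Submodule.span ℂ (Set.range ((V.mkQ ∘ A) ∘ k)))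
      ((Basis.span hk).constr ℂ fun i => (Pi.single i 1 : Fin (finrank ℂ ↥(S.map V.mkQ)) → ℂ))
    refine ⟨ψ, fun i => ?_⟩
    have h := LinearMap.congr_fun hψ (Basis.span hk i)
    rw [Basis.constr_basis] at h
    rw [← h, LinearMap.comp_apply, Submodule.subtype_apply, Basis.span_apply]
    rfl
  let g : Vec N →ₗ[ℂ] (Fin (finrank ℂ ↥(S.map V.mkQ)) → ℂ) := ψ ∘ₗ V.mkQ
  let M : Matrix (Fin (finrank ℂ ↥(S.map V.mkQ))) (Fin (finrank ℂ ↥(S.map V.mkQ)))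
      (MvPolynomial (Fin m × Fin N) ℂ) :=
    Matrix.of fun i j => ∑ l, MvPolynomial.C (g (Pi.single l 1) j) * MvPolynomial.X (k i, l)
  have hM : ∀ B : Fin m → Vec N, MvPolynomial.eval (fun q => B q.1 q.2) M.det =
      (Matrix.of fun i => g (B (k i))).det := by
    intro B
    rw [RingHom.map_det]
    congr 1
    ext i j
    simp only [M, RingHom.mapMatrix_apply, Matrix.map_apply, Matrix.of_apply, map_sum, map_mul,
      MvPolynomial.eval_C, MvPolynomial.eval_X]
    conv_rhs => rw [pi_eq_sum_univ' (B (k i)), map_sum, Finset.sum_apply]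
    refine Finset.sum_congr rfl fun l _ => ?_
    rw [map_smul, Pi.smul_apply, smul_eq_mul, mul_comm]
  -- The image of R modulo V has dimension at most m - r, less than the size of the minor, so the
  -- minor vanishes on frames of R.
  have h1 := hS.2 M.det (fun R hR B hB => by
    rw [hM]
    by_contra hdet
    have hli : LinearIndependent ℂ fun i => g (B (k i)) :=
      Matrix.linearIndependent_rows_of_det_ne_zero hdet
    have hli' : LinearIndependent ℂ fun i => V.mkQ (B (k i)) := LinearIndependent.of_comp ψ hli
    have hc := finrank_span_eq_card hli'
    have hle : Submodule.span ℂ (Set.range fun i => V.mkQ (B (k i))) ≤ R.map V.mkQ := by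
      rw [Submodule.span_le]
      rintro _ ⟨i, rfl⟩
      refine ⟨_, ?_, rfl⟩
      rw [← hB.2]
      exact Submodule.subset_span ⟨_, rfl⟩
    have := Submodule.finrank_mono hle
    rw [hc, Fintype.card_fin] at this
    have h2 := hquot R
    have h4 := hquot S
    have h3 := hY R hR
    rw [hB.finrank_eq] at h2
    omega) A hA
  rw [hM] at h1
  have : (Matrix.of fun i => g (A (k i))) = 1 := by
    ext i j
    rw [Matrix.of_apply, Matrix.one_apply]
    simp only [g, LinearMap.comp_apply, hψ, Pi.single_apply, eq_comm]
  rw [this, Matrix.det_one] at h1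
  exact one_ne_zero h1

end Closure


/-! ### Counting elements of Schubert symbols -/

section Counting

/-- The number of elements of `P` in `[1, c]`. -/
def cnt (P : Finset ℕ) (c : ℕ) : ℕ := (P ∩ Finset.Icc 1 c).card

variable {P : Finset ℕ} {c d N m n : ℕ}

theorem cnt_zero (P : Finset ℕ) : cnt P 0 = 0 := by simp [cnt]

theorem cnt_succ_of_mem (h : c + 1 ∈ P) : cnt P (c + 1) = cnt P c + 1 := by
  rw [cnt, cnt, ← Finset.insert_Icc_right_eq_Icc_add_one (by omega),
    Finset.inter_insert_of_mem h, Finset.card_insert_of_notMem (by simp)]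

theorem cnt_succ_of_notMem (h : c + 1 ∉ P) : cnt P (c + 1) = cnt P c := by
  rw [cnt, cnt, ← Finset.insert_Icc_right_eq_Icc_add_one (by omega),
    Finset.inter_insert_of_notMem h]

theorem cnt_succ_le : cnt P (c + 1) ≤ cnt P c + 1 := by
  by_cases h : c + 1 ∈ P
  · rw [cnt_succ_of_mem h]
  · rw [cnt_succ_of_notMem h]; omega

theorem cnt_sub_one (h1 : 1 ≤ c) (h : c ∈ P) : cnt P c = cnt P (c - 1) + 1 := by
  obtain ⟨d, rfl⟩ := Nat.exists_eq_add_of_le' h1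
  exact cnt_succ_of_mem h

theorem cnt_sub_one_of_notMem (h1 : 1 ≤ c) (h : c ∉ P) : cnt P c = cnt P (c - 1) := by
  obtain ⟨d, rfl⟩ := Nat.exists_eq_add_of_le' h1
  exact cnt_succ_of_notMem h

theorem IsSymbol.cnt_self (hP : IsSymbol N m P) : cnt P N = m := by
  rw [cnt, Finset.inter_eq_left.2 hP.1, hP.2.1]

theorem IsSymbol.mem_bar_iff (hP : IsSymbol N m P) (h1 : 1 ≤ c) (h2 : c ≤ N) :
    c ∈ bar N P ↔ N + 1 - c ∈ P := by
  rw [bar, Finset.mem_image]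
  constructor
  · rintro ⟨d, hd, rfl⟩
    have := Finset.mem_Icc.1 (hP.1 hd)
    rwa [show N + 1 - (N + 1 - d) = d by omega]
  · exact fun h => ⟨_, h, by omega⟩

theorem IsSymbol.bar (hP : IsSymbol N m P) : IsSymbol N m (bar N P) := by
  refine ⟨?_, ?_, ?_⟩
  · intro c hc
    obtain ⟨d, hd, rfl⟩ := Finset.mem_image.1 hc
    have := Finset.mem_Icc.1 (hP.1 hd)
    rw [Finset.mem_Icc]
    omega
  · rw [IsoGrass.bar, Finset.card_image_of_injOn, hP.2.1]
    intro c hc d hd h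
    have := Finset.mem_Icc.1 (hP.1 hc)
    have := Finset.mem_Icc.1 (hP.1 hd)
    simp only at h
    omega
  · intro c' hc' d' hd'
    obtain ⟨c, hc, rfl⟩ := Finset.mem_image.1 hc'
    obtain ⟨d, hd, rfl⟩ := Finset.mem_image.1 hd'
    have := Finset.mem_Icc.1 (hP.1 hc)
    have := Finset.mem_Icc.1 (hP.1 hd)
    have := hP.2.2 c hc d hd
    omega

/-- Reflection carries [1, c] to [N+1-c, N], the complement of [1, N-c]. -/
theorem IsSymbol.cnt_bar (hP : IsSymbol N m P) (hc : c ≤ N) :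
    cnt (IsoGrass.bar N P) c + cnt P (N - c) = m := by
  induction c with
  | zero => rw [cnt_zero, zero_add, Nat.sub_zero, hP.cnt_self]
  | succ c ih =>
    have h := ih (by omega)
    have hm := hP.mem_bar_iff (c := c + 1) (by omega) hc
    rw [show N + 1 - (c + 1) = N - c by omega] at hm
    by_cases h1 : N - c ∈ P
    · rw [cnt_succ_of_mem (hm.2 h1)]
      rw [cnt_sub_one (by omega) h1] at h
      rw [show N - (c + 1) = N - c - 1 by omega]
      omega
    · rw [cnt_succ_of_notMem (fun h' => h1 (hm.1 h'))]
      rw [cnt_sub_one_of_notMem (by omega) h1] at h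
      rw [show N - (c + 1) = N - c - 1 by omega]
      omega

/-- If `[c+1, n+1] ⊆ [P]`, then exactly half of `[c+1, N-c]` lies in `P`. -/
theorem IsSymbol.cnt_sub (hP : IsSymbol (2 * n + 2) m P) (hc : c ≤ n + 1)
    (h : ∀ i, c < i → i ≤ n + 1 → i ∈ P ∨ 2 * n + 3 - i ∈ P) :
    cnt P (2 * n + 2 - c) = cnt P c + (n + 1 - c) := by
  obtain ⟨k, hk⟩ : ∃ k, c + k = n + 1 := ⟨n + 1 - c, by omega⟩
  induction k generalizing c with
  | zero => rw [show 2 * n + 2 - c = c by omega]; omega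
  | succ k ih =>
    have h1 := ih (c := c + 1) (by omega) (fun i hi => h i (by omega)) (by omega)
    have h2 : cnt P (2 * n + 2 - c - 1) = cnt P (2 * n + 2 - (c + 1)) := by
      rw [show 2 * n + 2 - c - 1 = 2 * n + 2 - (c + 1) by omega]
    by_cases h3 : c + 1 ∈ P
    · have h4 : 2 * n + 2 - c ∉ P := fun h4 => hP.2.2 _ h3 _ h4 (by omega)
      rw [cnt_sub_one_of_notMem (by omega) h4]
      rw [cnt_succ_of_mem h3] at h1
      omega
    · have h4 : 2 * n + 2 - c ∈ P := by
        have := (h (c + 1) (by omega) (by omega)).resolve_left h3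
        rwa [show 2 * n + 3 - (c + 1) = 2 * n + 2 - c by omega] at this
      rw [cnt_sub_one (by omega) h4]
      rw [cnt_succ_of_notMem h3] at h1
      omega

end Counting

/-! ### Rank conditions on Schubert cells and varieties -/

section Cells

variable {N m : ℕ} {ω : LinearMap.BilinForm ℂ (Vec N)} {e : Basis (Fin N) ℂ (Vec N)}
  {P : Finset ℕ} {S : Submodule ℂ (Vec N)}

theorem finrank_inf_stdFlag_of_mem_schubertCell (hS : S ∈ schubertCell ω m (stdFlag e) P)
    {c : ℕ} (hc : c ≤ N) : finrank ℂ ↥(S ⊓ stdFlag e c) = cnt P c := by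
  induction c with
  | zero => rw [stdFlag_zero, inf_bot_eq, finrank_bot, cnt_zero]
  | succ c ih =>
    have h := hS.2 (c + 1) (Finset.mem_Icc.2 ⟨by omega, hc⟩)
    rw [Nat.add_sub_cancel] at h
    have hle : S ⊓ stdFlag e c ≤ S ⊓ stdFlag e (c + 1) :=
      inf_le_inf_left S (stdFlag_mono e (by omega))
    have ih := ih (by omega)
    have hup := finrank_inf_stdFlag_succ_le e S c
    by_cases hP : c + 1 ∈ P
    · have := Submodule.finrank_lt_finrank_of_lt (h.1 hP)
      rw [cnt_succ_of_mem hP]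
      omega
    · have : S ⊓ stdFlag e c = S ⊓ stdFlag e (c + 1) :=
        hle.eq_of_not_lt fun h' => hP (h.2 h')
      rw [cnt_succ_of_notMem hP, ← this, ih]

/-- The equality valid on the cell survives in the closure only as an inequality. -/
theorem cnt_le_finrank_inf_stdFlag (hS : S ∈ schubertVariety ω m (stdFlag e) P)
    {c : ℕ} (hc : c ≤ N) : cnt P c ≤ finrank ℂ ↥(S ⊓ stdFlag e c) :=
  le_finrank_inf_of_mem_zariskiClosure _
    (fun _ hR => (finrank_inf_stdFlag_of_mem_schubertCell hR hc).ge) hS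

end Cells

/-! ### The form ω and its truncations f_c -/

section Forms

variable {N : ℕ} {ω : LinearMap.BilinForm ℂ (Vec N)} {e : Basis (Fin N) ℂ (Vec N)} {σ : ℂ}

/-- The factor σ treats the symmetric and skew cases together. The basis condition fixes ω(e_i, e_j)
only for i ≤ j, so it appears once i passes the middle. -/
theorem form_bvec_eq (hσ : ∀ v w, ω v w = σ * ω w v) (he : IsIsotropicBasis ω e) {i : ℕ}
    (hi : 1 ≤ i) (hiN : i ≤ N) (w : Vec N) :
    ω (bvec e i) w = (if 2 * i ≤ N + 1 then 1 else σ) * coord e (N + 1 - i) w := by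
  conv_lhs => rw [← sum_coord_smul_bvec e w, map_sum]
  rw [Finset.sum_eq_single (N + 1 - i)]
  · rw [map_smul, smul_eq_mul, mul_comm]
    congr 1
    split_ifs with h
    · rw [he i _ hi (by omega) (by omega), if_pos (by omega)]
    · rw [hσ, he _ i (by omega) (by omega) hiN, if_pos (by omega), mul_one]
  · intro j hj hne
    rw [Finset.mem_Icc] at hj
    rw [map_smul, smul_eq_mul]
    by_cases h : i ≤ j
    · rw [he i j hi h hj.2, if_neg (by omega), mul_zero]
    · rw [hσ, he j i hj.1 (by omega) hiN, if_neg (by omega), mul_zero, mul_zero]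
  · intro h
    exact absurd (Finset.mem_Icc.2 ⟨by omega, by omega⟩) h

theorem coord_eq_zero_of_form_bvec (hσ0 : σ ≠ 0) (hσ : ∀ v w, ω v w = σ * ω w v)
    (he : IsIsotropicBasis ω e) {i : ℕ} (hi : 1 ≤ i) (hiN : i ≤ N) {w : Vec N}
    (hw : ω (bvec e i) w = 0) : coord e (N + 1 - i) w = 0 := by
  rw [form_bvec_eq hσ he hi hiN] at hw
  refine (mul_eq_zero.1 hw).resolve_left ?_
  split_ifs
  · exact one_ne_zero
  · exact hσ0

theorem form_eq_sum (u v : Vec N) :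
    ω u v = ∑ i ∈ Finset.Icc 1 N, coord e i u * ω (bvec e i) v := by
  conv_lhs => rw [← sum_coord_smul_bvec e u]
  rw [map_sum, LinearMap.sum_apply]
  simp

/-- The bilinear form `∑_{i ≤ c} x_i ⊗ x_{N+1-i}`, whose diagonal is the quadric `f_c`. -/
noncomputable def partialForm (e : Basis (Fin N) ℂ (Vec N)) (c : ℕ) (u v : Vec N) : ℂ :=
  ∑ i ∈ Finset.Icc 1 c, coord e i u * coord e (N + 1 - i) v

theorem partialForm_add_left (c : ℕ) (u u' v : Vec N) :
    partialForm e c (u + u') v = partialForm e c u v + partialForm e c u' v := by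
  simp only [partialForm, map_add, add_mul, Finset.sum_add_distrib]

theorem partialForm_add_right (c : ℕ) (u v v' : Vec N) :
    partialForm e c u (v + v') = partialForm e c u v + partialForm e c u v' := by
  simp only [partialForm, map_add, mul_add, Finset.sum_add_distrib]

theorem partialForm_eq_zero_left {c : ℕ} (hc : c ≤ N) {u : Vec N}
    (hu : u ∈ stdFlag (revBasis e) (N - c)) (v : Vec N) : partialForm e c u v = 0 := by
  refine Finset.sum_eq_zero fun i hi => ?_
  rw [Finset.mem_Icc] at hi
  rw [(mem_stdFlag_revBasis_iff e).1 hu i hi.1 (by omega), zero_mul]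

theorem partialForm_eq_zero_right {c : ℕ} (hc : c ≤ N) (u : Vec N) {v : Vec N}
    (hv : v ∈ stdFlag e (N - c)) : partialForm e c u v = 0 := by
  refine Finset.sum_eq_zero fun i hi => ?_
  rw [Finset.mem_Icc] at hi
  rw [(mem_stdFlag_iff e).1 hv (N + 1 - i) (by omega) (by omega), mul_zero]

/-- Only indices i ≤ c ≤ N/2 contribute, where no sign occurs; this is why one formula serves all
types. -/
theorem form_eq_partialForm_of_left (hσ : ∀ v w, ω v w = σ * ω w v) (he : IsIsotropicBasis ω e)
    {c : ℕ} (hc : 2 * c ≤ N) {u : Vec N} (hu : u ∈ stdFlag e c) (v : Vec N) :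
    ω u v = partialForm e c u v := by
  rw [form_eq_sum (e := e), partialForm]
  symm
  have hsub : Finset.Icc 1 c ⊆ Finset.Icc 1 N := Finset.Icc_subset_Icc_right (by omega)
  rw [← Finset.sum_subset hsub (fun i hi hic => by
    rw [Finset.mem_Icc] at hi hic
    rw [(mem_stdFlag_iff e).1 hu i (by omega) hi.2, zero_mul])]
  refine Finset.sum_congr rfl fun i hi => ?_
  rw [Finset.mem_Icc] at hi
  rw [form_bvec_eq hσ he hi.1 (by omega), if_pos (by omega), one_mul]

theorem form_eq_partialForm_of_right (hσ : ∀ v w, ω v w = σ * ω w v) (he : IsIsotropicBasis ω e)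
    {c : ℕ} (hc : 2 * c ≤ N) (u : Vec N) {v : Vec N} (hv : v ∈ stdFlag (revBasis e) c) :
    ω u v = partialForm e c u v := by
  rw [form_eq_sum (e := e), partialForm]
  symm
  have hsub : Finset.Icc 1 c ⊆ Finset.Icc 1 N := Finset.Icc_subset_Icc_right (by omega)
  rw [← Finset.sum_subset hsub (fun i hi hic => by
    rw [Finset.mem_Icc] at hi hic
    rw [form_bvec_eq hσ he hi.1 hi.2,
      (mem_stdFlag_revBasis_iff e).1 hv (N + 1 - i) (by omega) (by omega), mul_zero, mul_zero])]
  refine Finset.sum_congr rfl fun i hi => ?_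
  rw [Finset.mem_Icc] at hi
  rw [form_bvec_eq hσ he hi.1 (by omega), if_pos (by omega), one_mul]

/-- The first c coordinates of v vanish, so f_c(u + v) is ω(u, u + v). -/
theorem partialForm_self_eq_zero_of_left (hσ : ∀ v w, ω v w = σ * ω w v)
    (he : IsIsotropicBasis ω e) {c : ℕ} (hc : 2 * c ≤ N) {u v : Vec N} (hu : u ∈ stdFlag e c)
    (hv : v ∈ stdFlag (revBasis e) (N - c)) (h : ω u (u + v) = 0) :
    partialForm e c (u + v) (u + v) = 0 := by
  rw [partialForm_add_left, partialForm_eq_zero_left (by omega) hv, add_zero,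
    ← form_eq_partialForm_of_left hσ he hc hu, h]

theorem partialForm_self_eq_zero_of_right (hσ : ∀ v w, ω v w = σ * ω w v)
    (he : IsIsotropicBasis ω e) {c : ℕ} (hc : 2 * c ≤ N) {u v : Vec N}
    (hu : u ∈ stdFlag e (N - c)) (hv : v ∈ stdFlag (revBasis e) c) (h : ω (u + v) v = 0) :
    partialForm e c (u + v) (u + v) = 0 := by
  rw [partialForm_add_right, partialForm_eq_zero_right (by omega) _ hu, zero_add,
    ← form_eq_partialForm_of_right hσ he hc _ hv, h]

theorem form_stdFlag_eq_zero (hσ : ∀ v w, ω v w = σ * ω w v) (he : IsIsotropicBasis ω e)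
    {c d : ℕ} (hcd : c + d ≤ N) {u v : Vec N} (hu : u ∈ stdFlag e c) (hv : v ∈ stdFlag e d) :
    ω u v = 0 := by
  rw [form_eq_sum (e := e)]
  refine Finset.sum_eq_zero fun i hi => ?_
  rw [Finset.mem_Icc] at hi
  by_cases h : c < i
  · rw [(mem_stdFlag_iff e).1 hu i h hi.2, zero_mul]
  · rw [form_bvec_eq hσ he hi.1 hi.2, (mem_stdFlag_iff e).1 hv _ (by omega) (by omega), mul_zero,
      mul_zero]

/-- Splitting of a vector along `⟨e_1, …, e_c⟩`, `⟨e_{c+1}, …, e_{N-c}⟩`,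
`⟨e_{N+1-c}, …, e_N⟩`. -/
theorem exists_splitting (hσ : ∀ v w, ω v w = σ * ω w v) (he : IsIsotropicBasis ω e)
    {c : ℕ} (hc : 2 * c ≤ N) (w : Vec N) :
    ∃ u ∈ stdFlag e c, ∃ z ∈ stdFlag e (N - c) ⊓ stdFlag (revBasis e) (N - c),
      ∃ v ∈ stdFlag (revBasis e) c, u + z + v = w ∧ partialForm e c w w = ω u v ∧
        ∀ i, c < i → i ≤ N - c → coord e i z = coord e i w := by
  have key : ∀ I : Finset ℕ, I ⊆ Finset.Icc 1 N → ∀ i, 1 ≤ i → i ≤ N →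
      coord e i (∑ j ∈ I, coord e j w • bvec e j) = if i ∈ I then coord e i w else 0 := by
    intro I hI i hi hiN
    rw [map_sum]
    have : ∀ j ∈ I, coord e i (coord e j w • bvec e j) = if i = j then coord e i w else 0 := by
      intro j hj
      have hj' := Finset.mem_Icc.1 (hI hj)
      rw [map_smul, coord_bvec e hi hiN hj'.1 hj'.2]
      split_ifs with h
      · rw [h]; simp
      · simp
    rw [Finset.sum_congr rfl this, Finset.sum_ite_eq]
  have k1 := key (Finset.Icc 1 c) (Finset.Icc_subset_Icc_right (by omega))
  have k2 := key (Finset.Icc (c + 1) (N - c))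
    (Finset.Icc_subset_Icc (by omega) (by omega))
  have k3 := key (Finset.Icc (N - c + 1) N) (Finset.Icc_subset_Icc_left (by omega))
  set u := ∑ j ∈ Finset.Icc 1 c, coord e j w • bvec e j
  set z := ∑ j ∈ Finset.Icc (c + 1) (N - c), coord e j w • bvec e j
  set v := ∑ j ∈ Finset.Icc (N - c + 1) N, coord e j w • bvec e j
  have hu : u ∈ stdFlag e c := by
    rw [mem_stdFlag_iff]
    intro i hi hiN
    rw [k1 i (by omega) hiN, if_neg (by rw [Finset.mem_Icc]; omega)]
  have hz1 : z ∈ stdFlag e (N - c) := by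
    rw [mem_stdFlag_iff]
    intro i hi hiN
    rw [k2 i (by omega) hiN, if_neg (by rw [Finset.mem_Icc]; omega)]
  have hz2 : z ∈ stdFlag (revBasis e) (N - c) := by
    rw [mem_stdFlag_revBasis_iff]
    intro i hi hiN
    rw [k2 i (by omega) (by omega), if_neg (by rw [Finset.mem_Icc]; omega)]
  have hv : v ∈ stdFlag (revBasis e) c := by
    rw [mem_stdFlag_revBasis_iff]
    intro i hi hiN
    rw [k3 i (by omega) (by omega), if_neg (by rw [Finset.mem_Icc]; omega)]
  have hw : u + z + v = w := by
    refine eq_of_forall_coord e fun i hi hiN => ?_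
    rw [map_add, map_add, k1 i hi hiN, k2 i hi hiN, k3 i hi hiN]
    simp only [Finset.mem_Icc]
    by_cases h1 : i ≤ c
    · rw [if_pos ⟨hi, h1⟩, if_neg (by omega), if_neg (by omega)]; ring
    · by_cases h2 : i ≤ N - c
      · rw [if_neg (by omega), if_pos (by omega), if_neg (by omega)]; ring
      · rw [if_neg (by omega), if_neg (by omega), if_pos (by omega)]; ring
  refine ⟨u, hu, z, ⟨hz1, hz2⟩, v, hv, hw, ?_, fun i hi hiN => ?_⟩
  · rw [form_eq_partialForm_of_left hσ he hc hu]
    refine Finset.sum_congr rfl fun i hi => ?_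
    rw [Finset.mem_Icc] at hi
    rw [k1 i hi.1 (by omega), k3 (N + 1 - i) (by omega) (by omega),
      if_pos (Finset.mem_Icc.2 hi), if_pos (by rw [Finset.mem_Icc]; omega)]
  · rw [k2 i (by omega) (by omega), if_pos (by rw [Finset.mem_Icc]; omega)]

theorem IsIsotropicBasis.revBasis (hs : ∀ v w, ω v w = ω w v) (he : IsIsotropicBasis ω e) :
    IsIsotropicBasis ω (revBasis e) := by
  intro i j hi hij hj
  rw [bvec_revBasis e hi (by omega), bvec_revBasis e (by omega) hj, hs,
    he _ _ (by omega) (by omega) (by omega)]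
  congr 1
  rw [eq_iff_iff]
  omega

/-- The outer pieces are isotropic and the middle piece is orthogonal to both. -/
theorem form_self_eq (hs : ∀ v w, ω v w = ω w v) (he : IsIsotropicBasis ω e)
    {c : ℕ} (hc : 2 * c ≤ N) {u z v : Vec N} (hu : u ∈ stdFlag e c)
    (hz : z ∈ stdFlag e (N - c) ⊓ stdFlag (revBasis e) (N - c))
    (hv : v ∈ stdFlag (revBasis e) c) :
    ω (u + z + v) (u + z + v) = 2 * ω u v + ω z z := by
  have hσ : ∀ v w, ω v w = 1 * ω w v := fun v w => by rw [one_mul, hs]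
  have e1 := form_stdFlag_eq_zero hσ he (by omega) hu hu
  have e2 := form_stdFlag_eq_zero hσ he (by omega) hu hz.1
  have e3 := form_stdFlag_eq_zero hσ (he.revBasis hs) (by omega) hv hv
  have e4 := form_stdFlag_eq_zero hσ (he.revBasis hs) (by omega) hv hz.2
  simp only [map_add, LinearMap.add_apply]
  rw [hs v u, hs z u, hs z v, e1, e2, e3, e4]
  ring

theorem nondegenerate_of_isIsotropicBasis (hσ0 : σ ≠ 0) (hσ : ∀ v w, ω v w = σ * ω w v)
    (he : IsIsotropicBasis ω e) : ω.Nondegenerate := by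
  have hr : ∀ w, (∀ v, ω v w = 0) → w = 0 := by
    intro w hw
    refine eq_of_forall_coord e fun i hi hiN => ?_
    have := coord_eq_zero_of_form_bvec hσ0 hσ he (i := N + 1 - i) (by omega) (by omega) (hw _)
    rw [map_zero, ← this, show N + 1 - (N + 1 - i) = i by omega]
  exact ⟨fun v hv => hr v fun w => by rw [hσ, hv, mul_zero], hr⟩

end Forms


/-! ### The opposite flag and the middle step in type D -/

section OppositeFlag

variable {N n m : ℕ} {τ : LieType} {ω : LinearMap.BilinForm ℂ (Vec N)}
  {e : Basis (Fin N) ℂ (Vec N)} {P T : Finset ℕ} {S : Submodule ℂ (Vec N)}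

/-- The subspace `⟨e_1, …, e_n, e_{n+2}⟩`. -/
noncomputable def swappedFlag (e : Basis (Fin N) ℂ (Vec N)) (n : ℕ) : Submodule ℂ (Vec N) :=
  stdFlag e (n + 2) ⊓ LinearMap.ker (coord e (n + 1))

theorem oppFlag_eq {j : ℕ} (hj : j ≤ N) (h : ¬(τ = LieType.D ∧ Even n ∧ j = n + 1)) :
    oppFlag τ n e j = stdFlag (revBasis e) j := by
  ext v
  rw [oppFlag, if_neg h, mem_span_bvec_iff, mem_stdFlag_revBasis_iff]
  constructor
  · intro h i hi hiN
    exact h i hi (by omega) (by rw [Set.mem_Icc]; omega)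
  · intro h i hi hiN hI
    exact h i hi (by rw [Set.mem_Icc] at hI; omega)

theorem oppFlag_eq_swappedFlag (hN : N = 2 * n + 2) (hn : Even n) :
    oppFlag .D n e (n + 1) = swappedFlag (revBasis e) n := by
  ext v
  rw [oppFlag, if_pos ⟨rfl, hn, rfl⟩, mem_span_bvec_iff, swappedFlag, Submodule.mem_inf,
    mem_stdFlag_revBasis_iff, LinearMap.mem_ker, coord_revBasis e (by omega) (by omega)]
  constructor
  · intro h
    refine ⟨fun i hi hiN => h i hi (by omega) ?_, h _ (by omega) (by omega) ?_⟩ <;>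
    · rw [Set.mem_insert_iff, Set.mem_Icc]
      omega
  · rintro ⟨h1, h2⟩ i hi hiN hI
    rw [Set.mem_insert_iff, Set.mem_Icc] at hI
    by_cases hi2 : i = N + 1 - (n + 1)
    · rw [hi2, h2]
    · exact h1 i hi (by omega)

theorem form_self_eq_partialForm (hs : ∀ v w, ω v w = ω w v) (he : IsIsotropicBasis ω e) {k : ℕ}
    (hN : N = 2 * k) (w : Vec N) : ω w w = 2 * partialForm e k w w := by
  have hσ : ∀ v w, ω v w = 1 * ω w v := fun v w => by rw [one_mul, hs]
  obtain ⟨u, hu, z, hz, v, hv, hw, hp, -⟩ := exists_splitting hσ he (c := k) hN.ge w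
  have hz0 : z = 0 := by
    have := stdFlag_inf_stdFlag_revBasis e (c := N - k) (d := N - k) (by omega)
    rwa [this, Submodule.mem_bot] at hz
  rw [hp, ← hw, form_self_eq hs he hN.ge hu hz hv, hz0, map_zero, add_zero]

/-- On F_{n+2} the quadratic form degenerates to x_{n+1} x_{n+2}, so each isotropic vector there
lies in one of the two Lagrangians between F_n and F_{n+2}. -/
theorem coord_mul_coord_eq_zero (hs : ∀ v w, ω v w = ω w v) (he : IsIsotropicBasis ω e)
    (hN : N = 2 * n + 2) {v : Vec N} (hv : v ∈ stdFlag e (n + 2)) (hvv : ω v v = 0) :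
    coord e (n + 1) v * coord e (n + 2) v = 0 := by
  rw [form_self_eq_partialForm hs he (k := n + 1) (by omega), partialForm,
    Finset.sum_eq_single (n + 1)] at hvv
  · rw [show N + 1 - (n + 1) = n + 2 by omega] at hvv
    simpa using hvv
  · intro i hi hne
    rw [Finset.mem_Icc] at hi
    rw [(mem_stdFlag_iff e).1 hv (N + 1 - i) (by omega) (by omega), mul_zero]
  · intro h
    exact absurd (Finset.mem_Icc.2 ⟨by omega, by omega⟩) h

theorem inf_stdFlag_lt_iff {c : ℕ} :
    S ⊓ stdFlag e c < S ⊓ stdFlag e (c + 1) ↔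
      ∃ v ∈ S ⊓ stdFlag e (c + 1), coord e (c + 1) v ≠ 0 := by
  rw [SetLike.lt_iff_le_and_exists, ← stdFlag_inf_ker_coord e (c := c)]
  constructor
  · rintro ⟨-, v, hv, hv'⟩
    exact ⟨v, hv, fun h => hv' ⟨hv.1, hv.2, h⟩⟩
  · rintro ⟨v, hv, hv'⟩
    exact ⟨inf_le_inf_left _ inf_le_left, v, hv, fun h => hv' h.2.2⟩

theorem inf_swappedFlag_lt_iff :
    S ⊓ swappedFlag e n < S ⊓ stdFlag e (n + 2) ↔
      ∃ v ∈ S ⊓ stdFlag e (n + 2), coord e (n + 1) v ≠ 0 := by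
  rw [SetLike.lt_iff_le_and_exists, swappedFlag]
  constructor
  · rintro ⟨-, v, hv, hv'⟩
    exact ⟨v, hv, fun h => hv' ⟨hv.1, hv.2, h⟩⟩
  · rintro ⟨v, hv, hv'⟩
    exact ⟨inf_le_inf_left _ inf_le_left, v, hv, fun h => hv' h.2.2⟩

theorem inf_lt_inf_swappedFlag_iff :
    S ⊓ stdFlag e n < S ⊓ swappedFlag e n ↔
      ∃ v ∈ S ⊓ swappedFlag e n, coord e (n + 2) v ≠ 0 := by
  have hle : stdFlag e n ≤ swappedFlag e n := by
    rw [← stdFlag_inf_ker_coord e (c := n)]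
    exact inf_le_inf_right _ (stdFlag_mono e (by omega))
  have key : ∀ v ∈ swappedFlag e n, v ∈ stdFlag e n ↔ coord e (n + 2) v = 0 := by
    intro v hv
    rw [← stdFlag_inf_ker_coord e (c := n), ← stdFlag_inf_ker_coord e (c := n + 1)]
    exact ⟨fun h => h.1.2, fun h => ⟨⟨hv.1, h⟩, hv.2⟩⟩
  rw [SetLike.lt_iff_le_and_exists]
  constructor
  · rintro ⟨-, v, hv, hv'⟩
    exact ⟨v, hv, fun h => hv' ⟨hv.1, (key v hv.2).2 h⟩⟩
  · rintro ⟨v, hv, hv'⟩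
    exact ⟨inf_le_inf_left _ hle, v, hv, fun h => hv' ((key v hv.2).1 h.2)⟩

/-- With the next lemma: swapping the middle Lagrangian of the flag interchanges the jumps at n+1
and n+2. -/
theorem inf_swappedFlag_lt_iff_inf_stdFlag_lt (hs : ∀ v w, ω v w = ω w v)
    (he : IsIsotropicBasis ω e) (hN : N = 2 * n + 2) (hS : ∀ v ∈ S, ∀ w ∈ S, ω v w = 0) :
    S ⊓ swappedFlag e n < S ⊓ stdFlag e (n + 2) ↔ S ⊓ stdFlag e n < S ⊓ stdFlag e (n + 1) := by
  rw [inf_swappedFlag_lt_iff, inf_stdFlag_lt_iff]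
  constructor
  · rintro ⟨v, hv, hv0⟩
    refine ⟨v, ⟨hv.1, ?_⟩, hv0⟩
    rw [← stdFlag_inf_ker_coord e (c := n + 1)]
    exact ⟨hv.2, (mul_eq_zero.1 (coord_mul_coord_eq_zero hs he hN hv.2
      (hS v hv.1 v hv.1))).resolve_left hv0⟩
  · rintro ⟨v, hv, hv0⟩
    exact ⟨v, ⟨hv.1, stdFlag_mono e (by omega) hv.2⟩, hv0⟩

theorem inf_lt_inf_swappedFlag_iff_inf_stdFlag_lt (hs : ∀ v w, ω v w = ω w v)
    (he : IsIsotropicBasis ω e) (hN : N = 2 * n + 2) (hS : ∀ v ∈ S, ∀ w ∈ S, ω v w = 0) :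
    S ⊓ stdFlag e n < S ⊓ swappedFlag e n ↔
      S ⊓ stdFlag e (n + 1) < S ⊓ stdFlag e (n + 2) := by
  rw [inf_lt_inf_swappedFlag_iff, inf_stdFlag_lt_iff (c := n + 1)]
  constructor
  · rintro ⟨v, hv, hv0⟩
    exact ⟨v, ⟨hv.1, hv.2.1⟩, hv0⟩
  · rintro ⟨v, hv, hv0⟩
    exact ⟨v, ⟨hv.1, hv.2, (mul_eq_zero.1 (coord_mul_coord_eq_zero hs he hN hv.2
      (hS v hv.1 v hv.1))).resolve_right hv0⟩, hv0⟩

theorem mem_image_swap_iff {a b c : ℕ} {s : Finset ℕ} :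
    c ∈ s.image (Equiv.swap a b) ↔ Equiv.swap a b c ∈ s := by
  rw [Finset.mem_image]
  constructor
  · rintro ⟨d, hd, rfl⟩
    rwa [Equiv.swap_apply_self]
  · exact fun h => ⟨_, h, Equiv.swap_apply_self _ _ _⟩

/-- The conventions for the opposite flag and the dual symbol in type `D` with `n` even cancel. -/
theorem schubertCell_oppFlag_subset (hN : τ = LieType.D → N = 2 * n + 2)
    (hs : τ = LieType.D → ∀ v w, ω v w = ω w v) (he : IsIsotropicBasis ω e) :
    schubertCell ω m (oppFlag τ n e) (dualSymbol τ n N T) ⊆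
      schubertCell ω m (stdFlag (revBasis e)) (bar N T) := by
  rintro S ⟨hS, h⟩
  refine ⟨hS, fun c hc => ?_⟩
  have hcN := Finset.mem_Icc.1 hc
  have h' := h c hc
  by_cases hex : τ = LieType.D ∧ Even n
  · obtain ⟨rfl, hn⟩ := hex
    have hN := hN rfl
    have hs := hs rfl
    have her := he.revBasis hs
    have hF : ∀ j ≤ N, j ≠ n + 1 → oppFlag LieType.D n e j = stdFlag (revBasis e) j :=
      fun j hj hj' => oppFlag_eq hj fun h => hj' h.2.2
    have hF1 := oppFlag_eq_swappedFlag (e := e) hN hn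
    have hd : ∀ c, c ∈ dualSymbol LieType.D n N T ↔ Equiv.swap (n + 1) (n + 2) c ∈ bar N T := by
      intro c
      rw [dualSymbol, if_pos ⟨rfl, hn⟩, mem_image_swap_iff]
    by_cases h1 : c = n + 1
    · have h2 := h (n + 2) (Finset.mem_Icc.2 ⟨by omega, by omega⟩)
      rw [hd, Equiv.swap_apply_right, Nat.add_sub_assoc (by omega), hF1,
        hF (n + 2) (by omega) (by omega),
        inf_swappedFlag_lt_iff_inf_stdFlag_lt hs her hN hS.2] at h2
      rw [h1]
      exact h2
    · by_cases h2 : c = n + 2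
      · have h2' := h (n + 1) (Finset.mem_Icc.2 ⟨by omega, by omega⟩)
        rw [hd, Equiv.swap_apply_left, Nat.add_sub_cancel, hF1, hF n (by omega) (by omega),
          inf_lt_inf_swappedFlag_iff_inf_stdFlag_lt hs her hN hS.2] at h2'
        rw [h2]
        exact h2'
      · rwa [hd, Equiv.swap_apply_of_ne_of_ne h1 h2, hF _ (by omega) (by omega),
          hF _ (by omega) h1] at h'
  · have hF : ∀ j ≤ N, oppFlag τ n e j = stdFlag (revBasis e) j :=
      fun j hj => oppFlag_eq hj fun h => hex ⟨h.1, h.2.1⟩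
    rwa [dualSymbol, if_neg hex, hF _ (by omega), hF _ hcN.2] at h'

/-- A symbol containing n+2 omits n+1, so on the cell the whole of R ∩ F_{n+2} lies in the swapped
Lagrangian, a condition that passes to the closure. -/
theorem cnt_le_finrank_inf_swappedFlag (hs : ∀ v w, ω v w = ω w v) (he : IsIsotropicBasis ω e)
    (hN : N = 2 * n + 2) (hP : IsSymbol N m P) (hn : n + 2 ∈ P)
    (hS : S ∈ schubertVariety ω m (stdFlag e) P) :
    cnt P (n + 2) ≤ finrank ℂ ↥(S ⊓ swappedFlag e n) := by
  refine le_finrank_inf_of_mem_zariskiClosure _ (fun R hR => ?_) hS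
  have h1 : n + 1 ∉ P := fun h => hP.2.2 _ h _ hn (by omega)
  have h2 := finrank_inf_stdFlag_of_mem_schubertCell hR (c := n + 2) (by omega)
  have h4 : ¬(R ⊓ stdFlag e n < R ⊓ stdFlag e (n + 1)) := fun h =>
    h1 ((hR.2 (n + 1) (Finset.mem_Icc.2 ⟨by omega, by omega⟩)).2 h)
  rw [← inf_swappedFlag_lt_iff_inf_stdFlag_lt hs he hN hR.1.2] at h4
  have h5 : R ⊓ swappedFlag e n ≤ R ⊓ stdFlag e (n + 2) := inf_le_inf_left _ inf_le_left
  rw [h5.eq_of_not_lt h4, h2]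

end OppositeFlag

/-! ### The Lagrangian attached to a flag step, and its family -/

section Parity

variable {N n m : ℕ} {ω : LinearMap.BilinForm ℂ (Vec N)} {e : Basis (Fin N) ℂ (Vec N)}
  {P Q : Finset ℕ} {S : Submodule ℂ (Vec N)}

/-- The subspace `F_c + (S ∩ F_c^⊥)` for the standard flag `F`. -/
noncomputable def hat (e : Basis (Fin N) ℂ (Vec N)) (S : Submodule ℂ (Vec N)) (c : ℕ) :
    Submodule ℂ (Vec N) :=
  stdFlag e c ⊔ (S ⊓ stdFlag e (N - c))

theorem hat_le {c : ℕ} (hc : 2 * c ≤ N) : hat e S c ≤ stdFlag e (N - c) :=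
  sup_le (stdFlag_mono e (by omega)) inf_le_right

theorem finrank_hat_inf {c d : ℕ} (hc : 2 * c ≤ N) (hcd : c ≤ d) (hd : d ≤ N - c) :
    finrank ℂ ↥(hat e S c ⊓ stdFlag e d) + finrank ℂ ↥(S ⊓ stdFlag e c) =
      c + finrank ℂ ↥(S ⊓ stdFlag e d) := by
  have h1 : hat e S c ⊓ stdFlag e d = stdFlag e c ⊔ (S ⊓ stdFlag e d) := by
    rw [hat, sup_inf_assoc_of_le _ (stdFlag_mono e hcd), inf_assoc,
      inf_eq_right.2 (stdFlag_mono e hd)]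
  have h2 := Submodule.finrank_sup_add_finrank_inf_eq (stdFlag e c) (S ⊓ stdFlag e d)
  have h3 : stdFlag e c ⊓ (S ⊓ stdFlag e d) = S ⊓ stdFlag e c := by
    rw [inf_left_comm, inf_eq_left.2 (stdFlag_mono e hcd)]
  rw [h3, finrank_stdFlag e (by omega)] at h2
  rw [h1, h2]

theorem finrank_hat {c : ℕ} (hc : 2 * c ≤ N) :
    finrank ℂ (hat e S c) + finrank ℂ ↥(S ⊓ stdFlag e c) =
      c + finrank ℂ ↥(S ⊓ stdFlag e (N - c)) := by
  have := finrank_hat_inf (e := e) (S := S) hc (d := N - c) (by omega) le_rfl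
  rwa [inf_eq_left.2 (hat_le hc)] at this

theorem hat_isotropic (hs : ∀ v w, ω v w = ω w v) (he : IsIsotropicBasis ω e)
    (hS : ∀ v ∈ S, ∀ w ∈ S, ω v w = 0) {c : ℕ} (hc : 2 * c ≤ N) :
    ∀ v ∈ hat e S c, ∀ w ∈ hat e S c, ω v w = 0 := by
  have hσ : ∀ v w, ω v w = 1 * ω w v := fun v w => by rw [one_mul, hs]
  intro v hv w hw
  have hw' := hat_le hc hw
  obtain ⟨a, ha, b, hb, rfl⟩ := Submodule.mem_sup.1 hv
  obtain ⟨a', ha', b', hb', rfl⟩ := Submodule.mem_sup.1 hw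
  rw [map_add ω a b, LinearMap.add_apply, form_stdFlag_eq_zero hσ he (by omega) ha hw', map_add,
    hs b a', form_stdFlag_eq_zero hσ he (by omega) ha' hb.2, hS b hb.1 b' hb'.1]
  simp

theorem nondegenerate_of_symm (hs : ∀ v w, ω v w = ω w v) (he : IsIsotropicBasis ω e) :
    ω.Nondegenerate :=
  nondegenerate_of_isIsotropicBasis one_ne_zero (fun v w => by rw [one_mul, hs]) he

/-- The isotropic space `hat e S c` has dimension at most n+1; equality here is exactly the case in
which it is Lagrangian. -/
theorem finrank_inf_stdFlag_sub_le (hs : ∀ v w, ω v w = ω w v) (he : IsIsotropicBasis ω e)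
    (hN : N = 2 * n + 2) (hS : ∀ v ∈ S, ∀ w ∈ S, ω v w = 0) {c : ℕ} (hc : c ≤ n + 1) :
    finrank ℂ ↥(S ⊓ stdFlag e (N - c)) ≤ finrank ℂ ↥(S ⊓ stdFlag e c) + (n + 1 - c) := by
  have h1 := two_mul_finrank_le_of_isotropic (nondegenerate_of_symm hs he)
    (hat_isotropic hs he hS (c := c) (by omega))
  have h2 := finrank_hat (e := e) (S := S) (c := c) (by omega)
  rw [finrank_fin_fun] at h1
  omega

theorem isLagrangian_hat (hs : ∀ v w, ω v w = ω w v) (he : IsIsotropicBasis ω e)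
    (hN : N = 2 * n + 2) (hS : ∀ v ∈ S, ∀ w ∈ S, ω v w = 0) {c : ℕ} (hc : c ≤ n + 1)
    (hd : finrank ℂ ↥(S ⊓ stdFlag e (N - c)) = finrank ℂ ↥(S ⊓ stdFlag e c) + (n + 1 - c)) :
    IsLagrangian ω (hat e S c) := by
  refine ⟨hat_isotropic hs he hS (by omega), ?_⟩
  have h2 := finrank_hat (e := e) (S := S) (c := c) (by omega)
  rw [finrank_fin_fun]
  omega

theorem isLagrangian_stdFlag (hs : ∀ v w, ω v w = ω w v) (he : IsIsotropicBasis ω e)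
    (hN : N = 2 * n + 2) : IsLagrangian ω (stdFlag e (n + 1)) := by
  have hσ : ∀ v w, ω v w = 1 * ω w v := fun v w => by rw [one_mul, hs]
  refine ⟨fun v hv w hw => form_stdFlag_eq_zero hσ he (by omega) hv hw, ?_⟩
  rw [finrank_stdFlag e (by omega), finrank_fin_fun, hN]
  ring

/-- In type `D` the members of a Schubert variety satisfy, besides the rank conditions, a parity
condition at each step `c` with `[c+1, n+1] ⊆ [P]` where the rank is generic. -/
theorem even_finrank_inf_add_cnt (hs : ∀ v w, ω v w = ω w v) (he : IsIsotropicBasis ω e)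
    (hN : N = 2 * n + 2) (hP : IsSymbol N m P) {c : ℕ} (hc : c ≤ n + 1)
    (hcP : ∀ i, c < i → i ≤ n + 1 → i ∈ P ∨ 2 * n + 3 - i ∈ P)
    (hS : S ∈ schubertVariety ω m (stdFlag e) P)
    (hd : finrank ℂ ↥(S ⊓ stdFlag e c) = cnt P c) :
    finrank ℂ ↥(S ⊓ stdFlag e (N - c)) = cnt P c + (n + 1 - c) ∧
      Even (finrank ℂ ↥(S ⊓ stdFlag e (n + 1)) + cnt P (n + 1)) := by
  have hn := nondegenerate_of_symm hs he
  have hcount : cnt P (N - c) = cnt P c + (n + 1 - c) := by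
    subst hN
    exact hP.cnt_sub hc hcP
  have hdS : finrank ℂ ↥(S ⊓ stdFlag e (N - c)) = cnt P c + (n + 1 - c) := by
    have h1 := cnt_le_finrank_inf_stdFlag hS (c := N - c) (by omega)
    have h2 := finrank_inf_stdFlag_sub_le hs he hN hS.1.2 hc
    omega
  refine ⟨hdS, ?_⟩
  have hE := isLagrangian_stdFlag hs he hN
  have hLS := isLagrangian_hat hs he hN hS.1.2 hc (by rw [hdS, hd])
  -- M detects the family: if the parity at S is wrong, the Lagrangian of every R in the cell meets
  -- M in odd dimension, hence nontrivially.
  obtain ⟨M, hM, hSM⟩ := hLS.exists_disjoint hn hs hE (isLagrangian_stdFlag hs (he.revBasis hs) hN)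
    (stdFlag_inf_stdFlag_revBasis e (by omega))
  by_contra hodd
  have hdim := finrank_hat_inf (e := e) (S := S) (c := c) (d := n + 1) (by omega) hc (by omega)
  have hpS := hLS.even_add hn hs hE hM
  rw [hSM, finrank_bot] at hpS
  have hEc : stdFlag e c ⊓ M = ⊥ := by
    rw [eq_bot_iff, ← hSM]
    exact inf_le_inf_right _ le_sup_left
  have hEN : stdFlag e c ≤ stdFlag e (N - c) := stdFlag_mono e (by omega)
  -- The Lagrangian of R is not itself tested on the closure. Meeting M is rephrased as an excess
  -- intersection of R with a fixed subspace, which is a closed condition.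
  have hY : ∀ R ∈ schubertCell ω m (stdFlag e) P,
      cnt P c + 1 ≤ finrank ℂ ↥(R ⊓ (stdFlag e c ⊔ (M ⊓ stdFlag e (N - c)))) := by
    intro R hR
    have r0 := finrank_inf_stdFlag_of_mem_schubertCell hR (c := c) (by omega)
    have r1 := finrank_inf_stdFlag_of_mem_schubertCell hR (c := N - c) (by omega)
    have r2 := finrank_inf_stdFlag_of_mem_schubertCell hR (c := n + 1) (by omega)
    have hLR := isLagrangian_hat hs he hN hR.1.2 hc (by rw [r0, r1, hcount])
    have hdimR := finrank_hat_inf (e := e) (S := R) (c := c) (d := n + 1) (by omega) hc (by omega)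
    have hpR := hLR.even_add hn hs hE hM
    have hne : hat e R c ⊓ M ≠ ⊥ := by
      intro h
      rw [h, finrank_bot] at hpR
      have e1 := hLR.2
      have e2 := hLS.2
      grind
    obtain ⟨v, ⟨hv, hvM⟩, hv0⟩ := (Submodule.ne_bot_iff _).1 hne
    have hvN := hat_le (by omega) hv
    obtain ⟨a, ha, r, hr, rfl⟩ := Submodule.mem_sup.1 hv
    have hrV : r ∈ stdFlag e c ⊔ (M ⊓ stdFlag e (N - c)) :=
      Submodule.mem_sup.2 ⟨-a, neg_mem ha, a + r, ⟨hvM, hvN⟩, by abel⟩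
    have hrE : r ∉ stdFlag e c := by
      intro h
      have h' : a + r ∈ stdFlag e c ⊓ M := ⟨add_mem ha h, hvM⟩
      rw [hEc, Submodule.mem_bot] at h'
      exact hv0 h'
    have hlt : R ⊓ stdFlag e c < R ⊓ (stdFlag e c ⊔ (M ⊓ stdFlag e (N - c))) :=
      (inf_le_inf_left _ le_sup_left).lt_of_ne fun h => hrE (h.ge ⟨hr.1, hrV⟩).2
    have := Submodule.finrank_lt_finrank_of_lt hlt
    omega
  have hS' := le_finrank_inf_of_mem_zariskiClosure _ hY hS
  -- For S there is no excess, because M is transversal to its Lagrangian.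
  have hle : S ⊓ (stdFlag e c ⊔ (M ⊓ stdFlag e (N - c))) ≤ S ⊓ stdFlag e c := by
    rintro s ⟨hsS, hs'⟩
    refine ⟨hsS, ?_⟩
    obtain ⟨a, ha, v, hv, rfl⟩ := Submodule.mem_sup.1 hs'
    have hv' : v ∈ hat e S c ⊓ M := by
      refine ⟨Submodule.mem_sup.2 ⟨-a, neg_mem ha, a + v, ⟨hsS, ?_⟩, by abel⟩, hv.1⟩
      exact add_mem (hEN ha) hv.2
    rw [hSM, Submodule.mem_bot] at hv'
    rwa [hv', add_zero]
  have := Submodule.finrank_mono hle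
  omega

end Parity


/-! ### Equations at exceptional cuts in [1, n] -/

section Exceptional

variable {N n m : ℕ} {ω : LinearMap.BilinForm ℂ (Vec N)} {e : Basis (Fin N) ℂ (Vec N)}
  {P Q : Finset ℕ} {S : Submodule ℂ (Vec N)}

theorem stdFlag_inf_hat_inf_hat {c d : ℕ} (hd : 2 * d ≤ N) (hcd : c + (N - d) ≤ N) :
    stdFlag e c ⊓ (hat e S c ⊓ hat (revBasis e) S d) = ⊥ := by
  rw [eq_bot_iff, ← stdFlag_inf_stdFlag_revBasis e hcd]
  exact inf_le_inf_left _ (inf_le_right.trans (hat_le hd))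

/-- The intersection of the two Lagrangian subspaces obtained from `S` and a pair of opposite flags,
when `S` has nearly complementary position with respect to the flags. -/
theorem finrank_hat_inf_hat (hs : ∀ v w, ω v w = ω w v) (he : IsIsotropicBasis ω e)
    (hN : N = 2 * n + 2) (hS : S ∈ isoGr ω m) {c d : ℕ} (hc : c ≤ n + 1) (hd : d ≤ n + 1)
    (hA : finrank ℂ ↥(S ⊓ stdFlag e (N - c)) = finrank ℂ ↥(S ⊓ stdFlag e c) + (n + 1 - c))
    (hB : finrank ℂ ↥(S ⊓ stdFlag (revBasis e) (N - d)) =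
      finrank ℂ ↥(S ⊓ stdFlag (revBasis e) d) + (n + 1 - d))
    (hdim : finrank ℂ ↥(S ⊓ stdFlag e c) + finrank ℂ ↥(S ⊓ stdFlag (revBasis e) d) +
      (n + 1 - c) + (n + 1 - d) + 1 = m + (n + 1 - min c d))
    (hpar : Even (finrank ℂ ↥(S ⊓ stdFlag e (n + 1)) +
      finrank ℂ ↥(S ⊓ stdFlag (revBasis e) (n + 1)) + m + 1)) :
    finrank ℂ ↥(hat e S c ⊓ hat (revBasis e) S d) = n + 1 - min c d ∧
      (hat e S c ⊓ hat (revBasis e) S d ≤ S ∨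
        ∀ w ∈ S, ∃ a ∈ S ⊓ stdFlag e (N - c), ∃ b ∈ S ⊓ stdFlag (revBasis e) (N - d),
          a + b = w) := by
  have hσ : ∀ v w, ω v w = 1 * ω w v := fun v w => by rw [one_mul, hs]
  have hn := nondegenerate_of_symm hs he
  have her := he.revBasis hs
  have h1 := isLagrangian_hat hs he hN hS.2 hc hA
  have h2 := isLagrangian_hat hs her hN hS.2 hd hB
  have hE := isLagrangian_stdFlag hs he hN
  have hE' := isLagrangian_stdFlag hs her hN
  -- Comparing families through F_{n+1} and F'_{n+1} expresses the parity of dim(A ∩ B) by the ranks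
  -- of S at the two middle steps.
  have p1 := h1.even_add hn hs hE hE'
  have p2 := h1.even_add hn hs h2 hE'
  have q1 := finrank_hat_inf (e := e) (S := S) (c := c) (d := n + 1) (by omega) hc (by omega)
  have q2 := finrank_hat_inf (e := revBasis e) (S := S) (c := d) (d := n + 1) (by omega) hd
    (by omega)
  rw [stdFlag_inf_stdFlag_revBasis e (by omega), finrank_bot] at p1
  have hfin := h1.2
  rw [finrank_fin_fun] at hfin
  -- F_{min c d} lies in A and misses B, which is contained in F'_{N-d}.
  have hup : finrank ℂ ↥(hat e S c ⊓ hat (revBasis e) S d) ≤ n + 1 - min c d := by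
    have i1 : stdFlag e (min c d) ⊓ (hat e S c ⊓ hat (revBasis e) S d) = ⊥ := by
      rw [eq_bot_iff, ← stdFlag_inf_stdFlag_revBasis e (c := min c d) (d := N - d) (by omega)]
      exact inf_le_inf_left _ (inf_le_right.trans (hat_le (by omega)))
    have i2 : stdFlag e (min c d) ≤ hat e S c :=
      (stdFlag_mono e (by omega)).trans le_sup_left
    have i3 := finrank_add_le_of_inf_eq_bot i2 inf_le_left i1
    rw [finrank_stdFlag e (by omega)] at i3
    omega
  have hle : (S ⊓ stdFlag e (N - c)) ⊓ (S ⊓ stdFlag (revBasis e) (N - d)) ≤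
      hat e S c ⊓ hat (revBasis e) S d := inf_le_inf le_sup_right le_sup_right
  have hlow := Submodule.finrank_mono hle
  have hsum := Submodule.finrank_sup_add_finrank_inf_eq (S ⊓ stdFlag e (N - c))
    (S ⊓ stdFlag (revBasis e) (N - d))
  have hsup := Submodule.finrank_mono
    (sup_le inf_le_left inf_le_left : (S ⊓ stdFlag e (N - c)) ⊔
      (S ⊓ stdFlag (revBasis e) (N - d)) ≤ S)
  rw [hS.1] at hsup
  -- The two pieces of S overlap in dimension at least one less than the upper bound; parity
  -- excludes the smaller value.
  have hδ : finrank ℂ ↥(hat e S c ⊓ hat (revBasis e) S d) = n + 1 - min c d := by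
    rw [Nat.even_iff] at p1 p2 hpar
    omega
  refine ⟨hδ, ?_⟩
  -- Either the overlap of the two pieces fills A ∩ B, or it is one smaller and the pieces span S.
  by_cases hcase : n + 1 - min c d ≤
      finrank ℂ ↥((S ⊓ stdFlag e (N - c)) ⊓ (S ⊓ stdFlag (revBasis e) (N - d)))
  · left
    rw [← Submodule.eq_of_le_of_finrank_le hle (by rw [hδ]; exact hcase)]
    exact inf_le_left.trans inf_le_left
  · right
    intro w hw
    refine exists_add_of_finrank inf_le_left inf_le_left ?_ hw
    rw [hS.1]
    omega

/-- For c ≤ d the subspaces F_c and A ∩ B of A are independent and their dimensions add up to n+1.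
-/
theorem stdFlag_sup_hat_inf_hat (hs : ∀ v w, ω v w = ω w v) (he : IsIsotropicBasis ω e)
    (hN : N = 2 * n + 2) (hS : S ∈ isoGr ω m) {c d : ℕ} (hcd : c ≤ d) (hd : d ≤ n + 1)
    (hA : finrank ℂ ↥(S ⊓ stdFlag e (N - c)) = finrank ℂ ↥(S ⊓ stdFlag e c) + (n + 1 - c))
    (hM : finrank ℂ ↥(hat e S c ⊓ hat (revBasis e) S d) = n + 1 - c) :
    stdFlag e c ⊔ (hat e S c ⊓ hat (revBasis e) S d) = hat e S c := by
  have h1 := (isLagrangian_hat hs he hN hS.2 (by omega) hA).2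
  rw [finrank_fin_fun] at h1
  refine sup_eq_of_finrank le_sup_left inf_le_left ?_
  rw [stdFlag_inf_hat_inf_hat (by omega) (by omega), finrank_bot, hM, finrank_stdFlag e (by omega)]
  omega

/-- The data of an exceptional cut at `c ∈ [1, n]`, in a form symmetric in the two opposite
flags: `P` and `Q` are the symbols of the Schubert varieties for the flags of `e` and of the
reversed basis. -/
structure IsExceptionalPair (n m : ℕ) (P Q : Finset ℕ) (c : ℕ) : Prop where
  symbolP : IsSymbol (2 * n + 2) m P
  symbolQ : IsSymbol (2 * n + 2) m Q
  pos : 1 ≤ c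
  le : c ≤ n
  coverP : ∀ i, c < i → i ≤ n + 1 → i ∈ P ∨ 2 * n + 3 - i ∈ P
  coverQ : ∀ i, c < i → i ≤ n + 1 → i ∈ Q ∨ 2 * n + 3 - i ∈ Q
  card : cnt P c + cnt Q c + (n + 1 - c) + 1 = m
  parity : Even (cnt P (n + 1) + cnt Q (n + 1) + m + 1)

theorem IsExceptionalPair.symm {c : ℕ} (h : IsExceptionalPair n m P Q c) :
    IsExceptionalPair n m Q P c where
  symbolP := h.symbolQ
  symbolQ := h.symbolP
  pos := h.pos
  le := h.le
  coverP := h.coverQ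
  coverQ := h.coverP
  card := by have := h.card; omega
  parity := by rw [add_comm (cnt Q _)]; exact h.parity

/-- The conclusion of `finrank_hat_inf_hat` in terms of symbols. -/
theorem IsExceptionalPair.dichotomy {c : ℕ} (h : IsExceptionalPair n m P Q c)
    (hs : ∀ v w, ω v w = ω w v) (he : IsIsotropicBasis ω e) (hN : N = 2 * n + 2)
    (hSP : S ∈ schubertVariety ω m (stdFlag e) P)
    (hSQ : S ∈ schubertVariety ω m (stdFlag (revBasis e)) Q) {d : ℕ} (hd : d ≤ n + 1)
    (hcover : ∀ i, d < i → i ≤ n + 1 → i ∈ Q ∨ 2 * n + 3 - i ∈ Q)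
    (hA : finrank ℂ ↥(S ⊓ stdFlag e c) = cnt P c)
    (hB : finrank ℂ ↥(S ⊓ stdFlag (revBasis e) d) = cnt Q d)
    (hdim : cnt P c + cnt Q d + (n + 1 - c) + (n + 1 - d) + 1 = m + (n + 1 - min c d)) :
    IsLagrangian ω (hat e S c) ∧ IsLagrangian ω (hat (revBasis e) S d) ∧
    finrank ℂ ↥(S ⊓ stdFlag e (N - c)) = finrank ℂ ↥(S ⊓ stdFlag e c) + (n + 1 - c) ∧
    finrank ℂ ↥(hat e S c ⊓ hat (revBasis e) S d) = n + 1 - min c d ∧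
      (hat e S c ⊓ hat (revBasis e) S d ≤ S ∨
        ∀ w ∈ S, ∃ a ∈ S ⊓ stdFlag e (N - c), ∃ b ∈ S ⊓ stdFlag (revBasis e) (N - d),
          a + b = w) := by
  have hle := h.le
  have her := he.revBasis hs
  have a1 := even_finrank_inf_add_cnt hs he hN (hN ▸ h.symbolP) (by omega) h.coverP hSP hA
  have b1 := even_finrank_inf_add_cnt hs her hN (hN ▸ h.symbolQ) hd hcover hSQ hB
  have hA' : finrank ℂ ↥(S ⊓ stdFlag e (N - c)) =
      finrank ℂ ↥(S ⊓ stdFlag e c) + (n + 1 - c) := by rw [a1.1, hA]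
  have hB' : finrank ℂ ↥(S ⊓ stdFlag (revBasis e) (N - d)) =
      finrank ℂ ↥(S ⊓ stdFlag (revBasis e) d) + (n + 1 - d) := by rw [b1.1, hB]
  refine ⟨isLagrangian_hat hs he hN hSP.1.2 (by omega) hA',
    isLagrangian_hat hs her hN hSP.1.2 hd hB', hA', ?_⟩
  refine finrank_hat_inf_hat hs he hN hSP.1 (by omega) hd hA' hB' (by rw [hA, hB]; exact hdim) ?_
  have := h.parity
  have a2 := a1.2
  have b2 := b1.2
  rw [Nat.even_iff] at *
  omega

theorem IsExceptionalPair.cnt_sub {c : ℕ} (h : IsExceptionalPair n m P Q c)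
    (hN : N = 2 * n + 2) : cnt P (N - c) = cnt P c + (n + 1 - c) := by
  have hle := h.le
  rw [hN]
  exact h.symbolP.cnt_sub (by omega) h.coverP

/-- The quadratic equation of an exceptional cut. -/
theorem IsExceptionalPair.partialForm_eq_zero {c : ℕ} (h : IsExceptionalPair n m P Q c)
    (hs : ∀ v w, ω v w = ω w v) (he : IsIsotropicBasis ω e) (hN : N = 2 * n + 2)
    (hSP : S ∈ schubertVariety ω m (stdFlag e) P)
    (hSQ : S ∈ schubertVariety ω m (stdFlag (revBasis e)) Q) {w : Vec N} (hw : w ∈ S) :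
    partialForm e c w w = 0 := by
  have hle := h.le
  have hpos := h.pos
  have hcard := h.card
  have hσ : ∀ v w, ω v w = 1 * ω w v := fun v w => by rw [one_mul, hs]
  have her := he.revBasis hs
  have hS := hSP.1
  have dA := cnt_le_finrank_inf_stdFlag hSP (c := c) (by omega)
  have dA' := cnt_le_finrank_inf_stdFlag hSP (c := N - c) (by omega)
  have dB := cnt_le_finrank_inf_stdFlag hSQ (c := c) (by omega)
  have dB' := cnt_le_finrank_inf_stdFlag hSQ (c := N - c) (by omega)
  rw [h.cnt_sub hN] at dA'
  rw [h.symm.cnt_sub hN] at dB'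
  -- One extra dimension in S ∩ F_c makes c behave like a visible cut; an excess on the opposite
  -- side below does the same for N - c.
  by_cases hA : finrank ℂ ↥(S ⊓ stdFlag e c) = cnt P c
  swap
  · have h0 : (S ⊓ stdFlag e c) ⊓ (S ⊓ stdFlag (revBasis e) (N - c)) = ⊥ := by
      rw [eq_bot_iff, ← stdFlag_inf_stdFlag_revBasis e (c := c) (d := N - c) (by omega)]
      exact inf_le_inf inf_le_right inf_le_right
    obtain ⟨u, hu, v, hv, rfl⟩ := exists_add_of_finrank (S := S) inf_le_left inf_le_left
      (by rw [h0, finrank_bot, hS.1]; omega) hw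
    exact partialForm_self_eq_zero_of_left hσ he (by omega) hu.2 hv.2 (hS.2 _ hu.1 _ hw)
  by_cases hB : finrank ℂ ↥(S ⊓ stdFlag (revBasis e) c) = cnt Q c
  swap
  · have h0 : (S ⊓ stdFlag e (N - c)) ⊓ (S ⊓ stdFlag (revBasis e) c) = ⊥ := by
      rw [eq_bot_iff, ← stdFlag_inf_stdFlag_revBasis e (c := N - c) (d := c) (by omega)]
      exact inf_le_inf inf_le_right inf_le_right
    obtain ⟨u, hu, v, hv, rfl⟩ := exists_add_of_finrank (S := S) inf_le_left inf_le_left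
      (by rw [h0, finrank_bot, hS.1]; omega) hw
    exact partialForm_self_eq_zero_of_right hσ he (by omega) hu.2 hv.2 (hS.2 _ hw _ hv.1)
  obtain ⟨hL1, hL2, hA', hdM, hcase⟩ := h.dichotomy hs he hN hSP hSQ (by omega) h.coverQ hA hB
    (by rw [min_self]; omega)
  rw [min_self] at hdM
  have hsup := stdFlag_sup_hat_inf_hat hs he hN hS le_rfl (by omega) hA' hdM
  rcases hcase with hM | hsum
  · obtain ⟨u, hu, z, hz, v, hv, hw', hp, -⟩ := exists_splitting hσ he (c := c) (by omega) w
    -- The middle part z of w is orthogonal to F_c and, as A ∩ B ⊆ S, to A ∩ B. So z lies in A^⊥ =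
    -- A, ω(z, z) = 0, and ω(w, w) = 0 leaves f_c(w) = ω(u, v) = 0.
    have hzL : z ∈ hat e S c := by
      refine hL1.mem_of_forall (nondegenerate_of_symm hs he) fun y hy => ?_
      rw [← hsup] at hy
      obtain ⟨ε, hε, s, hsM, rfl⟩ := Submodule.mem_sup.1 hy
      have e1 := hS.2 s (hM hsM) w hw
      rw [← hw', map_add, map_add,
        form_stdFlag_eq_zero hσ he (by omega) (hat_le (by omega) hsM.1) hu,
        form_stdFlag_eq_zero hσ her (by omega) (hat_le (by omega) hsM.2) hv] at e1
      rw [map_add, LinearMap.add_apply, form_stdFlag_eq_zero hσ he (by omega) hε hz.1, zero_add]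
      simpa using e1
    have e2 := form_self_eq hs he (c := c) (by omega) hu hz hv
    rw [hw', hS.2 w hw w hw, hL1.1 z hzL z hzL, add_zero] at e2
    rw [hp]
    exact (mul_eq_zero.1 e2.symm).resolve_left two_ne_zero
  · obtain ⟨a, ha, b, hb, rfl⟩ := hsum w hw
    have haL : a ∈ hat e S c := Submodule.mem_sup_right ha
    have hbL : b ∈ hat (revBasis e) S c := Submodule.mem_sup_right hb
    rw [← hsup] at haL
    obtain ⟨ε, hε, z, hz, rfl⟩ := Submodule.mem_sup.1 haL
    -- Everything cancels except ω(ε, b) = ω(a, b) - ω(z, b). The first term vanishes since a, b ∈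
    -- S, the second since z, b ∈ B.
    rw [partialForm_add_right, partialForm_eq_zero_right (by omega) _ ha.2, zero_add,
      partialForm_add_left, partialForm_eq_zero_left (by omega) hb.2, add_zero,
      partialForm_add_left, partialForm_eq_zero_left (by omega) (hat_le (by omega) hz.2),
      add_zero, ← form_eq_partialForm_of_left hσ he (by omega) hε]
    have e1 := hS.2 _ ha.1 b hb.1
    rwa [map_add, LinearMap.add_apply, hL2.1 z hz.2 b hbL, add_zero] at e1

/-- The linear equation of a lone star in column `c` next to an exceptional cut at `c` or,
dually, in column `N+1-c` next to an exceptional cut at `N-c`. -/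
theorem IsExceptionalPair.coord_rev_eq_zero {c : ℕ} (h : IsExceptionalPair n m P Q c)
    (hs : ∀ v w, ω v w = ω w v) (he : IsIsotropicBasis ω e) (hN : N = 2 * n + 2)
    (hSP : S ∈ schubertVariety ω m (stdFlag e) P)
    (hSQ : S ∈ schubertVariety ω m (stdFlag (revBasis e)) Q) (hQ : N + 1 - c ∈ Q)
    {w : Vec N} (hw : w ∈ S) : coord e (N + 1 - c) w = 0 := by
  have hle := h.le
  have hpos := h.pos
  have hcard := h.card
  have hσ : ∀ v w, ω v w = 1 * ω w v := fun v w => by rw [one_mul, hs]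
  have her := he.revBasis hs
  have hS := hSP.1
  have hcQ : c ∉ Q := fun hc => h.symbolQ.2.2 _ hc _ hQ (by omega)
  by_cases hec : bvec e c ∈ S
  · exact coord_eq_zero_of_form_bvec one_ne_zero hσ he hpos (by omega) (hS.2 _ hec _ hw)
  have dA := cnt_le_finrank_inf_stdFlag hSP (c := c) (by omega)
  have dA' := cnt_le_finrank_inf_stdFlag hSP (c := N - c) (by omega)
  have dB := cnt_le_finrank_inf_stdFlag hSQ (c := c - 1) (by omega)
  have dB' := cnt_le_finrank_inf_stdFlag hSQ (c := N + 1 - c) (by omega)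
  rw [h.cnt_sub hN] at dA'
  have hQ1 := cnt_sub_one_of_notMem hpos hcQ
  rw [cnt_sub_one (by omega) hQ, show N + 1 - c - 1 = N - c by omega, h.symm.cnt_sub hN] at dB'
  -- An excess here would put e_c in S, which has been excluded.
  by_cases hA : finrank ℂ ↥(S ⊓ stdFlag e c) = cnt P c
  swap
  · obtain ⟨v, ⟨hv1, hv2⟩, hv0⟩ := exists_ne_zero_mem_inf (S := S) (U := S ⊓ stdFlag e c)
      (W := S ⊓ stdFlag (revBasis e) (N + 1 - c)) inf_le_left inf_le_left
      (by rw [hS.1]; omega)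
    refine absurd (bvec_mem_of_coord e hpos (by omega) hv1.1 hv0 fun i hi hiN hic => ?_) hec
    by_cases hlt : c < i
    · exact (mem_stdFlag_iff e).1 hv1.2 i hlt hiN
    · exact (mem_stdFlag_revBasis_iff e).1 hv2.2 i hi (by omega)
  have hzero : ∀ a ∈ S ⊓ stdFlag e (N - c), coord e (N + 1 - c) a = 0 := fun a ha =>
    (mem_stdFlag_iff e).1 ha.2 _ (by omega) (by omega)
  by_cases hB : finrank ℂ ↥(S ⊓ stdFlag (revBasis e) (c - 1)) = cnt Q (c - 1)
  swap
  · have h0 : (S ⊓ stdFlag e (N - c)) ⊓ (S ⊓ stdFlag (revBasis e) (c - 1)) = ⊥ := by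
      rw [eq_bot_iff, ← stdFlag_inf_stdFlag_revBasis e (c := N - c) (d := c - 1) (by omega)]
      exact inf_le_inf inf_le_right inf_le_right
    obtain ⟨u, hu, v, hv, rfl⟩ := exists_add_of_finrank (S := S) inf_le_left inf_le_left
      (by rw [h0, finrank_bot, hS.1]; omega) hw
    rw [map_add, hzero u hu, (mem_stdFlag_revBasis_iff e).1 hv.2 _ (by omega) (by omega), add_zero]
  -- Since N+1-c ∈ Q, the covering of Q extends to column c. Taking d = c - 1 enlarges A ∩ B enough
  -- to meet F_c, and they can meet only along e_c.
  obtain ⟨hL1, hL2, hA', hdM, hcase⟩ := h.dichotomy hs he hN hSP hSQ (d := c - 1) (by omega)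
    (fun i hi hin => by
      by_cases hic : i = c
      · right
        rwa [hic, show 2 * n + 3 - c = N + 1 - c by omega]
      · exact h.coverQ i (by omega) hin) hA hB (by omega)
  have heM : bvec e c ∈ hat e S c ⊓ hat (revBasis e) S (c - 1) := by
    have hfin := hL1.2
    rw [finrank_fin_fun] at hfin
    obtain ⟨v, ⟨hv1, hv2⟩, hv0⟩ := exists_ne_zero_mem_inf (S := hat e S c) (U := stdFlag e c)
      (W := hat e S c ⊓ hat (revBasis e) S (c - 1)) le_sup_left inf_le_left
      (by rw [hdM, finrank_stdFlag e (by omega)]; omega)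
    refine bvec_mem_of_coord e hpos (by omega) hv2 hv0 fun i hi hiN hic => ?_
    by_cases hlt : c < i
    · exact (mem_stdFlag_iff e).1 hv1 i hlt hiN
    · exact (mem_stdFlag_revBasis_iff e).1 (hat_le (by omega) hv2.2) i hi (by omega)
  rcases hcase with hM | hsum
  · exact absurd (hM heM) hec
  · obtain ⟨a, ha, b, hb, rfl⟩ := hsum w hw
    have hb' := coord_eq_zero_of_form_bvec one_ne_zero hσ he hpos (by omega)
      (hL2.1 _ heM.2 b (Submodule.mem_sup_right hb))
    rw [map_add, hzero a ha, hb', add_zero]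

/-- The linear equation of a lone star in column `N-c` next to an exceptional cut at `N-c` or,
dually, in column `c+1` next to an exceptional cut at `c`. -/
theorem IsExceptionalPair.coord_succ_eq_zero {c : ℕ} (h : IsExceptionalPair n m P Q c)
    (hs : ∀ v w, ω v w = ω w v) (he : IsIsotropicBasis ω e) (hN : N = 2 * n + 2)
    (hSP : S ∈ schubertVariety ω m (stdFlag e) P)
    (hSQ : S ∈ schubertVariety ω m (stdFlag (revBasis e)) Q) (hQ : c + 1 ∈ Q)
    {w : Vec N} (hw : w ∈ S) : coord e (c + 1) w = 0 := by
  have hle := h.le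
  have hpos := h.pos
  have hcard := h.card
  have hσ : ∀ v w, ω v w = 1 * ω w v := fun v w => by rw [one_mul, hs]
  have her := he.revBasis hs
  have hS := hSP.1
  have hcQ : N - c ∉ Q := fun hc => h.symbolQ.2.2 _ hc _ hQ (by omega)
  by_cases hec : bvec e (N - c) ∈ S
  · have := coord_eq_zero_of_form_bvec one_ne_zero hσ he (i := N - c) (by omega) (by omega)
      (hS.2 _ hec _ hw)
    rwa [show N + 1 - (N - c) = c + 1 by omega] at this
  have dA := cnt_le_finrank_inf_stdFlag hSP (c := c) (by omega)
  have dA' := cnt_le_finrank_inf_stdFlag hSP (c := N - c) (by omega)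
  have dB := cnt_le_finrank_inf_stdFlag hSQ (c := c + 1) (by omega)
  have dB' := cnt_le_finrank_inf_stdFlag hSQ (c := N - (c + 1)) (by omega)
  rw [h.cnt_sub hN] at dA'
  have hQ1 := cnt_succ_of_mem hQ
  have hQ2 := cnt_sub_one_of_notMem (by omega) hcQ
  rw [h.symm.cnt_sub hN, show N - c - 1 = N - (c + 1) by omega] at hQ2
  have hzero : ∀ v ∈ stdFlag (revBasis e) (N - (c + 1)), coord e (c + 1) v = 0 := fun v hv =>
    (mem_stdFlag_revBasis_iff e).1 hv _ (by omega) (by omega)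
  have hzero' : ∀ u ∈ stdFlag e c, coord e (c + 1) u = 0 := fun u hu =>
    (mem_stdFlag_iff e).1 hu _ (by omega) (by omega)
  by_cases hA : finrank ℂ ↥(S ⊓ stdFlag e c) = cnt P c
  swap
  · have h0 : (S ⊓ stdFlag e c) ⊓ (S ⊓ stdFlag (revBasis e) (N - (c + 1))) = ⊥ := by
      rw [eq_bot_iff, ← stdFlag_inf_stdFlag_revBasis e (c := c) (d := N - (c + 1)) (by omega)]
      exact inf_le_inf inf_le_right inf_le_right
    obtain ⟨u, hu, v, hv, rfl⟩ := exists_add_of_finrank (S := S) inf_le_left inf_le_left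
      (by rw [h0, finrank_bot, hS.1]; omega) hw
    rw [map_add, hzero' u hu.2, hzero v hv.2, add_zero]
  have hcoord : ∀ v ∈ stdFlag e (N - c), v ∈ stdFlag (revBasis e) (c + 1) →
      ∀ i, 1 ≤ i → i ≤ N → i ≠ N - c → coord e i v = 0 := by
    intro v hv1 hv2 i hi hiN hic
    by_cases hlt : N - c < i
    · exact (mem_stdFlag_iff e).1 hv1 i hlt hiN
    · exact (mem_stdFlag_revBasis_iff e).1 hv2 i hi (by omega)
  by_cases hB : finrank ℂ ↥(S ⊓ stdFlag (revBasis e) (c + 1)) = cnt Q (c + 1)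
  swap
  · obtain ⟨v, ⟨hv1, hv2⟩, hv0⟩ := exists_ne_zero_mem_inf (S := S) (U := S ⊓ stdFlag e (N - c))
      (W := S ⊓ stdFlag (revBasis e) (c + 1)) inf_le_left inf_le_left
      (by rw [hS.1]; omega)
    exact absurd (bvec_mem_of_coord e (by omega) (by omega) hv1.1 hv0
      (hcoord v hv1.2 hv2.2)) hec
  -- With d = c + 1 the vector e_{N-c} lies in F'_{c+1} ⊆ B; it is orthogonal to F_c and to A ∩ B,
  -- hence lies in A too.
  obtain ⟨hL1, hL2, hA', hdM, hcase⟩ := h.dichotomy hs he hN hSP hSQ (d := c + 1) (by omega)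
    (fun i hi hin => h.coverQ i (by omega) hin) hA hB (by omega)
  rw [min_eq_left (by omega)] at hdM
  have hsup := stdFlag_sup_hat_inf_hat hs he hN hS (d := c + 1) (by omega) (by omega) hA' hdM
  have he2 : bvec e (N - c) ∈ hat (revBasis e) S (c + 1) := by
    refine Submodule.mem_sup_left ?_
    have := bvec_mem_stdFlag (revBasis e) (i := c + 1) (c := c + 1) (by omega) le_rfl
    rwa [bvec_revBasis e (by omega) (by omega), show N + 1 - (c + 1) = N - c by omega] at this
  have he1 : bvec e (N - c) ∈ hat e S c := by
    refine hL1.mem_of_forall (nondegenerate_of_symm hs he) fun y hy => ?_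
    rw [← hsup] at hy
    obtain ⟨ε, hε, s, hsM, rfl⟩ := Submodule.mem_sup.1 hy
    rw [map_add, LinearMap.add_apply, hL2.1 s hsM.2 _ he2, add_zero]
    exact form_stdFlag_eq_zero hσ he (by omega) hε
      (bvec_mem_stdFlag e (i := N - c) (c := N - c) (by omega) le_rfl)
  rcases hcase with hM | hsum
  · exact absurd (hM ⟨he1, he2⟩) hec
  · obtain ⟨a, ha, b, hb, rfl⟩ := hsum w hw
    have haL : a ∈ hat e S c := Submodule.mem_sup_right ha
    rw [← hsup] at haL
    obtain ⟨ε, hε, z, hz, rfl⟩ := Submodule.mem_sup.1 haL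
    rw [map_add, map_add, hzero' ε hε, hzero z (hat_le (by omega) hz.2), hzero b hb.2]
    simp

end Exceptional


/-! ### From diagram entries to counting functions -/

section Entries

variable {N n m : ℕ} {P T : Finset ℕ} {c : ℕ}

/-- Row conditions become inequalities between counts. The default N+1 exceeds every admissible c,
so rows beyond the last need no separate treatment. -/
theorem entry_le_iff (hP : P ⊆ Finset.Icc 1 N) (hc : c ≤ N) (i : ℕ) :
    entry N P i ≤ c ↔ i ≤ cnt P c := by
  rcases Nat.eq_zero_or_pos i with rfl | hi
  · simp [entry]
  rw [entry, if_neg (by omega)]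
  by_cases h : i - 1 < P.card
  swap
  · rw [List.getD_eq_default _ _ (by rw [Finset.length_sort]; omega)]
    have := Finset.card_le_card (Finset.inter_subset_left : P ∩ Finset.Icc 1 c ⊆ P)
    rw [← cnt] at this
    constructor <;> intro h' <;> omega
  obtain ⟨k, hk⟩ : ∃ k : Fin P.card, (k : ℕ) + 1 = i := ⟨⟨i - 1, h⟩, by simp only; omega⟩
  have hf : P.sort.getD (i - 1) (N + 1) = P.orderEmbOfFin rfl k := by
    rw [Finset.orderEmbOfFin_apply, List.getD_eq_getElem _ _ (by rw [Finset.length_sort]; omega)]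
    congr 1
    omega
  rw [hf]
  constructor
  · intro hle
    have hsub : (Finset.Iic k).map (P.orderEmbOfFin rfl).toEmbedding ⊆ P ∩ Finset.Icc 1 c := by
      intro x hx
      obtain ⟨j, hj, rfl⟩ := Finset.mem_map.1 hx
      have hjP : P.orderEmbOfFin rfl j ∈ P := Finset.orderEmbOfFin_mem P rfl j
      have h1 := Finset.mem_Icc.1 (hP hjP)
      have h2 : P.orderEmbOfFin rfl j ≤ P.orderEmbOfFin rfl k :=
        (P.orderEmbOfFin rfl).monotone (Finset.mem_Iic.1 hj)
      exact Finset.mem_inter.2 ⟨hjP, Finset.mem_Icc.2 ⟨h1.1, h2.trans hle⟩⟩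
    have := Finset.card_le_card hsub
    rw [Finset.card_map, Fin.card_Iic, ← cnt] at this
    omega
  · intro hle
    by_contra! hlt
    have hsub : P ∩ Finset.Icc 1 c ⊆ (Finset.Iio k).map (P.orderEmbOfFin rfl).toEmbedding := by
      intro x hx
      rw [Finset.mem_inter, Finset.mem_Icc] at hx
      have hx' : x ∈ Set.range (P.orderEmbOfFin rfl) := by
        rw [Finset.range_orderEmbOfFin]
        exact hx.1
      obtain ⟨j, rfl⟩ := hx'
      refine Finset.mem_map.2 ⟨j, Finset.mem_Iio.2 ?_, rfl⟩
      exact (P.orderEmbOfFin rfl).lt_iff_lt.1 (by omega)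
    have := Finset.card_le_card hsub
    rw [Finset.card_map, Fin.card_Iio, ← cnt] at this
    omega

theorem IsVisibleCut.cnt_le (hP : IsSymbol N m P) (hT : IsSymbol N m T)
    (h : IsVisibleCut N m P T c) : cnt T c ≤ cnt P c := by
  obtain ⟨hc, i, -, h1, h2⟩ := h
  rw [entry_le_iff hP.1 hc] at h1
  rw [← not_le, entry_le_iff hT.1 hc] at h2
  omega

theorem IsZeroColumn.cnt_le (hP : IsSymbol N m P) (hT : IsSymbol N m T)
    (h : IsZeroColumn N m P T c) : cnt T c ≤ cnt P (c - 1) := by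
  obtain ⟨h0, hc, i, -, h1, h2⟩ := h
  replace h1 := (entry_le_iff hP.1 (c := c - 1) (by omega) i).1 (by omega)
  rw [← not_le, entry_le_iff hT.1 hc] at h2
  omega

theorem mem_of_entry_eq (hP : IsSymbol N m P) {i : ℕ} (h0 : 1 ≤ c) (hc : c ≤ N)
    (h : entry N P i = c) : c ∈ P ∧ i = cnt P c := by
  have h1 := (entry_le_iff hP.1 hc i).1 h.le
  have h2 := (entry_le_iff hP.1 (c := c - 1) (by omega) i).not.1 (by omega)
  have hcP : c ∈ P := by
    by_contra hcP
    rw [cnt_sub_one_of_notMem h0 hcP] at h1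
    omega
  have := cnt_sub_one h0 hcP
  exact ⟨hcP, by omega⟩

theorem HasExceptionalCenterCut.cnt_le (hP : IsSymbol (2 * n + 2) m P)
    (hT : IsSymbol (2 * n + 2) m T) (h : HasExceptionalCenterCut n m P T) :
    (n + 2 ∈ P ∧ cnt T (n + 1) ≤ cnt P (n + 2)) ∨
      (n + 1 ∈ T ∧ cnt T (n + 1) ≤ cnt P (n + 1) + 1) := by
  obtain ⟨i, h1, -, ⟨h2, h3⟩ | ⟨h2, h3⟩⟩ := h
  · obtain ⟨h4, h5⟩ := mem_of_entry_eq hP (by omega) (by omega) h2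
    have h6 := (entry_le_iff hT.1 (c := n + 1) (by omega) (i + 1)).not.1 (by omega)
    exact Or.inl ⟨h4, by omega⟩
  · obtain ⟨h4, h5⟩ := mem_of_entry_eq hT (by omega) (by omega) h2
    have h6 := (entry_le_iff hP.1 (c := n + 1) (by omega) (i - 1)).1 (by omega)
    exact Or.inr ⟨h4, by omega⟩

/-- The covering at n+1 rules out type 2, so distinct types mean that the counts of P and T in [1,
n+1] have opposite parity; reflecting T gives the symmetric form. -/
theorem IsCutCandidate.isExceptionalPair (hP : IsSymbol (2 * n + 2) m P)
    (hT : IsSymbol (2 * n + 2) m T) (hc : IsCutCandidate n P T c)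
    (ht : symbolType n T ≠ symbolType n P) :
    IsExceptionalPair n m P (bar (2 * n + 2) T) c := by
  obtain ⟨h0, hcn, hsub, hcard⟩ := hc
  rw [← cnt, ← cnt] at hcard
  have hmem : ∀ i, c < i → i ≤ n + 1 →
      (i ∈ P ∨ 2 * n + 3 - i ∈ P) ∧ (i ∈ T ∨ 2 * n + 3 - i ∈ T) := by
    intro i hi hin
    have := hsub (Finset.mem_Icc.2 ⟨hi, hin⟩)
    rwa [Finset.mem_inter, Finset.mem_union, Finset.mem_union,
      hP.mem_bar_iff (by omega) (by omega), hT.mem_bar_iff (by omega) (by omega)] at this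
  have htype : ∀ R : Finset ℕ, (n + 1 ∈ R ∨ 2 * n + 3 - (n + 1) ∈ R) →
      symbolType n R = (n + 1 - cnt R (n + 1)) % 2 ∧ cnt R (n + 1) ≤ n + 1 := by
    intro R hR
    rw [show 2 * n + 3 - (n + 1) = n + 2 by omega] at hR
    rw [symbolType, if_pos hR, Finset.card_sdiff, Nat.card_Icc, Nat.add_sub_cancel, ← cnt]
    refine ⟨rfl, (Finset.card_le_card Finset.inter_subset_right).trans ?_⟩
    rw [Nat.card_Icc, Nat.add_sub_cancel]
  have hm := hmem (n + 1) (by omega) le_rfl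
  obtain ⟨tP, lP⟩ := htype P hm.1
  obtain ⟨tT, lT⟩ := htype T hm.2
  have b1 := hT.cnt_bar (c := c) (by omega)
  have b2 := hT.cnt_bar (c := n + 1) (by omega)
  rw [hT.cnt_sub (by omega) fun i hi hin => (hmem i hi hin).2] at b1
  rw [show 2 * n + 2 - (n + 1) = n + 1 by omega] at b2
  refine ⟨hP, hT.bar, h0, hcn, fun i hi hin => (hmem i hi hin).1, fun i hi hin => ?_, by omega, ?_⟩
  · rw [hT.mem_bar_iff (by omega) (by omega), hT.mem_bar_iff (by omega) (by omega),
      show 2 * n + 2 + 1 - (2 * n + 3 - i) = i by omega]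
    exact (hmem i hi hin).2.symm
  · rw [tP, tT] at ht
    rw [Nat.even_iff]
    omega

end Entries

/-! ### Equations from zero columns, cuts and lone stars -/

section Equations

variable {N n m : ℕ} {ω : LinearMap.BilinForm ℂ (Vec N)} {e : Basis (Fin N) ℂ (Vec N)} {σ : ℂ}
  {P T Q : Finset ℕ} {S : Submodule ℂ (Vec N)} {c : ℕ} {w : Vec N}

/-- For c + d ≤ N the two flag members are disjoint, so the rank bounds leave room for nothing else
in S. -/
theorem exists_add_of_cnt (hSP : S ∈ schubertVariety ω m (stdFlag e) P)
    (hSQ : S ∈ schubertVariety ω m (stdFlag (revBasis e)) Q) {c d : ℕ} (hcd : c + d ≤ N)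
    (h : m ≤ cnt P c + cnt Q d) (hw : w ∈ S) :
    ∃ u ∈ S ⊓ stdFlag e c, ∃ v ∈ S ⊓ stdFlag (revBasis e) d, u + v = w := by
  have dA := cnt_le_finrank_inf_stdFlag hSP (c := c) (by omega)
  have dB := cnt_le_finrank_inf_stdFlag hSQ (c := d) (by omega)
  have h0 : (S ⊓ stdFlag e c) ⊓ (S ⊓ stdFlag (revBasis e) d) = ⊥ := by
    rw [eq_bot_iff, ← stdFlag_inf_stdFlag_revBasis e hcd]
    exact inf_le_inf inf_le_right inf_le_right
  refine exists_add_of_finrank inf_le_left inf_le_left ?_ hw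
  rw [h0, finrank_bot, hSP.1.1]
  omega

/-- The linear equation of a zero column. -/
theorem coord_eq_zero_of_zeroColumn (hSP : S ∈ schubertVariety ω m (stdFlag e) P)
    (hSQ : S ∈ schubertVariety ω m (stdFlag (revBasis e)) (bar N T)) (hT : IsSymbol N m T)
    (h0 : 1 ≤ c) (hc : c ≤ N) (h : cnt T c ≤ cnt P (c - 1)) (hw : w ∈ S) : coord e c w = 0 := by
  have hb := hT.cnt_bar (c := N - c) (by omega)
  rw [show N - (N - c) = c by omega] at hb
  obtain ⟨u, hu, v, hv, rfl⟩ :=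
    exists_add_of_cnt hSP hSQ (c := c - 1) (d := N - c) (by omega) (by omega) hw
  rw [map_add, (mem_stdFlag_iff e).1 hu.2 c (by omega) hc,
    (mem_stdFlag_revBasis_iff e).1 hv.2 c h0 (by omega), add_zero]

/-- The linear equation of a lone star next to a visible cut. -/
theorem coord_eq_zero_of_loneStar (hσ0 : σ ≠ 0) (hσ : ∀ v w, ω v w = σ * ω w v)
    (he : IsIsotropicBasis ω e) (hSP : S ∈ schubertVariety ω m (stdFlag e) P)
    (hSQ : S ∈ schubertVariety ω m (stdFlag (revBasis e)) (bar N T)) (hT : IsSymbol N m T)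
    (h0 : 1 ≤ c) (hc : c ≤ N) (h : cnt T (c - 1) < cnt P c) (hw : w ∈ S) :
    coord e (N + 1 - c) w = 0 := by
  have dA := cnt_le_finrank_inf_stdFlag hSP hc
  have dB := cnt_le_finrank_inf_stdFlag hSQ (c := N + 1 - c) (by omega)
  have hb := hT.cnt_bar (c := N + 1 - c) (by omega)
  rw [show N - (N + 1 - c) = c - 1 by omega] at hb
  -- The rank bounds sum to more than m, and the two flag members share only the line of e_c.
  obtain ⟨v, ⟨hv1, hv2⟩, hv0⟩ := exists_ne_zero_mem_inf (S := S) (U := S ⊓ stdFlag e c)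
    (W := S ⊓ stdFlag (revBasis e) (N + 1 - c)) inf_le_left inf_le_left
    (by rw [hSP.1.1]; omega)
  have hec : bvec e c ∈ S := bvec_mem_of_coord e h0 hc hv1.1 hv0 fun i hi hiN hic => by
    by_cases hlt : c < i
    · exact (mem_stdFlag_iff e).1 hv1.2 i hlt hiN
    · exact (mem_stdFlag_revBasis_iff e).1 hv2.2 i hi (by omega)
  exact coord_eq_zero_of_form_bvec hσ0 hσ he h0 hc (hSP.1.2 _ hec _ hw)

/-- The quadratic equation of an apparent cut. -/
theorem partialForm_eq_zero_of_isApparentCut (hσ : ∀ v w, ω v w = σ * ω w v)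
    (he : IsIsotropicBasis ω e) (hSP : S ∈ schubertVariety ω m (stdFlag e) P)
    (hSQ : S ∈ schubertVariety ω m (stdFlag (revBasis e)) (bar N T)) (hP : IsSymbol N m P)
    (hT : IsSymbol N m T) (hc : 2 * c ≤ N) (h : IsApparentCut N m P T c) (hw : w ∈ S) :
    partialForm e c w w = 0 := by
  rcases h with ⟨-, h | h⟩
  · have h1 := h.cnt_le hP hT
    have hb := hT.cnt_bar (c := N - c) (by omega)
    rw [show N - (N - c) = c by omega] at hb
    obtain ⟨u, hu, v, hv, rfl⟩ :=
      exists_add_of_cnt hSP hSQ (c := c) (d := N - c) (by omega) (by omega) hw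
    exact partialForm_self_eq_zero_of_left hσ he hc hu.2 hv.2 (hSP.1.2 _ hu.1 _ hw)
  · have h1 := h.cnt_le hP hT
    have hb := hT.cnt_bar (c := c) (by omega)
    obtain ⟨u, hu, v, hv, rfl⟩ :=
      exists_add_of_cnt hSP hSQ (c := N - c) (d := c) (by omega) (by omega) hw
    exact partialForm_self_eq_zero_of_right hσ he hc hu.2 hv.2 (hSP.1.2 _ hw _ hv.1)

/-- The linear equation of a lone star next to an exceptional center cut. -/
theorem coord_eq_zero_of_centerCut (hs : ∀ v w, ω v w = ω w v) (he : IsIsotropicBasis ω e)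
    (hN : N = 2 * n + 2) (hP : IsSymbol N m P) (hSP : S ∈ schubertVariety ω m (stdFlag e) P)
    (hSQ : S ∈ schubertVariety ω m (stdFlag (revBasis e)) Q) (hn : n + 2 ∈ P)
    (h : m ≤ cnt P (n + 2) + cnt Q (n + 1)) (hw : w ∈ S) : coord e (n + 1) w = 0 := by
  have hσ : ∀ v w, ω v w = 1 * ω w v := fun v w => by rw [one_mul, hs]
  have dA := cnt_le_finrank_inf_swappedFlag hs he hN hP hn hSP
  have dB := cnt_le_finrank_inf_stdFlag hSQ (c := n + 1) (by omega)
  -- x_{n+1} vanishes on both pieces. If they are disjoint they span S; otherwise they share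
  -- e_{n+2}, whose orthogonality gives the equation.
  by_cases h0 : (S ⊓ swappedFlag e n) ⊓ (S ⊓ stdFlag (revBasis e) (n + 1)) = ⊥
  · obtain ⟨u, hu, v, hv, rfl⟩ := exists_add_of_finrank (S := S) inf_le_left inf_le_left
      (by rw [h0, finrank_bot, hSP.1.1]; omega) hw
    rw [map_add, LinearMap.mem_ker.1 hu.2.2,
      (mem_stdFlag_revBasis_iff e).1 hv.2 _ (by omega) (by omega), add_zero]
  · obtain ⟨v, ⟨hv1, hv2⟩, hv0⟩ := (Submodule.ne_bot_iff _).1 h0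
    have hec : bvec e (n + 2) ∈ S :=
      bvec_mem_of_coord e (by omega) (by omega) hv1.1 hv0 fun i hi hiN hic => by
        by_cases hlt : n + 2 < i
        · exact (mem_stdFlag_iff e).1 hv1.2.1 i hlt hiN
        · exact (mem_stdFlag_revBasis_iff e).1 hv2.2 i hi (by omega)
    have := coord_eq_zero_of_form_bvec one_ne_zero hσ he (by omega) (by omega)
      (hSP.1.2 _ hec _ hw)
    rwa [show N + 1 - (n + 2) = n + 1 by omega] at this

/-- The linear equation of a lone star next to an apparent cut. -/
theorem coord_eq_zero_of_isApparentCut (hσ0 : σ ≠ 0) (hσ : ∀ v w, ω v w = σ * ω w v)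
    (he : IsIsotropicBasis ω e) (hSP : S ∈ schubertVariety ω m (stdFlag e) P)
    (hSQ : S ∈ schubertVariety ω m (stdFlag (revBasis e)) (bar N T)) (hP : IsSymbol N m P)
    (hT : IsSymbol N m T) (h0 : 1 ≤ c) (hc : c ≤ N)
    (h : c ∈ T ∧ IsApparentCut N m P T c ∨ c ∈ P ∧ IsApparentCut N m P T (c - 1)) (hw : w ∈ S) :
    coord e (N + 1 - c) w = 0 := by
  rcases h with ⟨hmem, -, h | h⟩ | ⟨hmem, -, h | h⟩
  · refine coord_eq_zero_of_loneStar hσ0 hσ he hSP hSQ hT h0 hc ?_ hw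
    have h1 := h.cnt_le hP hT
    rw [cnt_sub_one h0 hmem] at h1
    omega
  · have h1 := h.cnt_le hP hT
    -- As c ∈ T excludes N+1-c from T, the visible cut at N - c yields the zero column inequality
    -- for N+1-c.
    refine coord_eq_zero_of_zeroColumn hSP hSQ hT (by omega) (by omega) ?_ hw
    rw [cnt_sub_one_of_notMem (by omega) (fun hn => hT.2.2 _ hmem _ hn (by omega)),
      show N + 1 - c - 1 = N - c by omega]
    exact h1
  · refine coord_eq_zero_of_loneStar hσ0 hσ he hSP hSQ hT h0 hc ?_ hw
    have h1 := h.cnt_le hP hT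
    rw [cnt_sub_one h0 hmem]
    omega
  · have h1 := h.cnt_le hP hT
    refine coord_eq_zero_of_zeroColumn hSP hSQ hT (by omega) (by omega) ?_ hw
    rw [← cnt_sub_one_of_notMem (by omega) (fun hn => hP.2.2 _ hmem _ hn (by omega))]
    rwa [show N - (c - 1) = N + 1 - c by omega] at h1

/-- The linear equation of a lone star next to an exceptional cut. -/
theorem coord_eq_zero_of_isExceptionalCut (hs : ∀ v w, ω v w = ω w v)
    (he : IsIsotropicBasis ω e) (hN : N = 2 * n + 2)
    (hSP : S ∈ schubertVariety ω m (stdFlag e) P)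
    (hSQ : S ∈ schubertVariety ω m (stdFlag (revBasis e)) (bar N T)) (hP : IsSymbol N m P)
    (hT : IsSymbol N m T) (h0 : 1 ≤ c) (hc : c ≤ N)
    (h : c ∈ T ∧ IsExceptionalCut n m P T c ∨ c ∈ P ∧ IsExceptionalCut n m P T (c - 1))
    (hw : w ∈ S) : coord e (N + 1 - c) w = 0 := by
  have her := he.revBasis hs
  have hSP' : S ∈ schubertVariety ω m (stdFlag (revBasis (revBasis e))) P := by
    rwa [revBasis_revBasis]
  rcases h with ⟨hmem, ⟨rfl, h⟩ | ⟨ht, d, hd, h⟩⟩ | ⟨hmem, ⟨hcn, h⟩ | ⟨ht, d, hd, h⟩⟩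
  · have h1 := h.cnt_le (hN ▸ hP) (hN ▸ hT)
    have hb := hT.cnt_bar (c := n + 2) (by omega)
    have hT1 := cnt_sub_one (by omega) hmem
    rw [show N - (n + 2) = n + 1 - 1 by omega] at hb
    have hP1 : cnt P (n + 2) ≤ cnt P (n + 1) + 1 := cnt_succ_le
    -- A star from T is a star from P after exchanging the two flags: n+1 ∈ T becomes n+2 ∈ `bar N
    -- T`.
    have := coord_eq_zero_of_centerCut hs her hN hT.bar hSQ hSP'
      ((hT.mem_bar_iff (by omega) (by omega)).2
        (by rwa [show N + 1 - (n + 2) = n + 1 by omega])) (by omega) hw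
    rwa [coord_revBasis e (by omega) (by omega)] at this
  · have hp := hd.isExceptionalPair (hN ▸ hP) (hN ▸ hT) ht
    rw [← hN] at hp
    have h2 := hp.pos
    have h3 := hp.le
    rcases h with rfl | rfl
    · exact hp.coord_rev_eq_zero hs he hN hSP hSQ
        ((hT.mem_bar_iff (by omega) (by omega)).2
          (by rwa [show N + 1 - (N + 1 - c) = c by omega])) hw
    · rw [show N + 1 - (2 * n + 2 - d) = d + 1 by omega]
      exact hp.coord_succ_eq_zero hs he hN hSP hSQ
        ((hT.mem_bar_iff (by omega) (by omega)).2
          (by rwa [show N + 1 - (d + 1) = 2 * n + 2 - d by omega])) hw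
  · obtain rfl : c = n + 2 := by omega
    have h1 := h.cnt_le (hN ▸ hP) (hN ▸ hT)
    have hb := hT.cnt_bar (c := n + 1) (by omega)
    have hP1 : cnt P (n + 2) = cnt P (n + 1) + 1 := cnt_succ_of_mem hmem
    rw [show N - (n + 1) = n + 1 by omega] at hb
    rw [show N + 1 - (n + 2) = n + 1 by omega]
    exact coord_eq_zero_of_centerCut hs he hN hP hSP hSQ hmem (by omega) hw
  · have hp := (hd.isExceptionalPair (hN ▸ hP) (hN ▸ hT) ht).symm
    rw [← hN] at hp
    have h2 := hp.pos
    have h3 := hp.le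
    rcases h with h | h
    · obtain rfl : c = d + 1 := by omega
      rw [← coord_revBasis e h0 hc]
      exact hp.coord_succ_eq_zero hs her hN hSQ hSP' hmem hw
    · obtain rfl : c = N + 1 - d := by omega
      rw [← coord_revBasis e h0 hc]
      exact hp.coord_rev_eq_zero hs her hN hSQ hSP' hmem hw

end Equations

/-! ### Assembling the equations -/

section Main

variable {τ : LieType} {n m : ℕ} {ω : LinearMap.BilinForm ℂ (Vec (ambDim τ n))}
  {e : Basis (Fin (ambDim τ n)) ℂ (Vec (ambDim τ n))} {P T : Finset ℕ}

theorem FormSymmetry.exists_sign (hω : FormSymmetry τ ω) :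
    ∃ σ : ℂ, σ ≠ 0 ∧ ∀ v w, ω v w = σ * ω w v := by
  cases τ with
  | C => exact ⟨-1, by norm_num, fun v w => by rw [neg_one_mul]; exact hω v w⟩
  | B => exact ⟨1, one_ne_zero, fun v w => by rw [one_mul]; exact hω v w⟩
  | D => exact ⟨1, one_ne_zero, fun v w => by rw [one_mul]; exact hω v w⟩

theorem FormSymmetry.symm (hω : FormSymmetry τ ω) (hτ : τ ≠ .C) : ∀ v w, ω v w = ω w v := by
  cases τ with
  | C => exact absurd rfl hτ
  | B => exact hω
  | D => exact hω

theorem quadForm_eq_partialForm {c : ℕ} (h : ¬(τ = .B ∧ c = n + 1)) (w : Vec (ambDim τ n)) :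
    quadForm τ n e c w = partialForm e c w w := by
  rw [quadForm, if_neg h, partialForm]

/-- The last quadratic form in types `B` and `D` is half of the form `ω(w, w)`. -/
theorem two_mul_quadForm (hω : FormSymmetry τ ω) (he : IsIsotropicBasis ω e) (hτ : τ ≠ .C)
    (w : Vec (ambDim τ n)) : 2 * quadForm τ n e (n + 1) w = ω w w := by
  have hs := hω.symm hτ
  have hσ : ∀ v w, ω v w = 1 * ω w v := fun v w => by rw [one_mul, hs]
  cases τ with
  | C => exact absurd rfl hτ
  | D =>
    rw [quadForm_eq_partialForm (by simp)]
    exact (form_self_eq_partialForm hs he (k := n + 1) (by simp only [ambDim]; ring) w).symm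
  | B =>
    have hN : ambDim .B n = 2 * n + 1 := rfl
    obtain ⟨u, hu, z, hz, v, hv, hw, hp, hcoord⟩ := exists_splitting hσ he (c := n) (by omega) w
    have hz' : z = coord e (n + 1) w • bvec e (n + 1) := by
      rw [← hcoord (n + 1) (by omega) (by omega)]
      refine eq_smul_bvec_of_mem e (by omega) (by omega) fun i hi hiN hin => ?_
      by_cases hlt : i ≤ n
      · exact (mem_stdFlag_revBasis_iff e).1 hz.2 i hi (by omega)
      · exact (mem_stdFlag_iff e).1 hz.1 i (by omega) hiN
    have hzz : ω z z = coord e (n + 1) w ^ 2 := by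
      rw [hz', map_smul, map_smul ω, LinearMap.smul_apply,
        he (n + 1) (n + 1) (by omega) le_rfl (by omega), if_pos (by omega)]
      simp only [smul_eq_mul]
      ring
    have h1 := form_self_eq hs he (by omega) hu hz hv
    rw [hw, ← hp, hzz] at h1
    rw [quadForm, if_pos ⟨rfl, rfl⟩, h1, partialForm]
    ring

theorem richardson_subset (hω : FormSymmetry τ ω) (he : IsIsotropicBasis ω e) :
    richardson τ n ω e m P T ⊆ schubertVariety ω m (stdFlag e) P ∩
      schubertVariety ω m (stdFlag (revBasis e)) (bar (ambDim τ n) T) :=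
  Set.inter_subset_inter_right _ (zariskiClosure_mono (schubertCell_oppFlag_subset
    (fun h => by rw [h]; rfl) (fun h => hω.symm (by simp [h])) he))

theorem openRichardson_subset : openRichardson τ n ω e m P T ⊆ richardson τ n ω e m P T :=
  Set.inter_subset_inter (subset_zariskiClosure fun _ h => h.1)
    (subset_zariskiClosure fun _ h => h.1)

theorem satisfiesEquations_of_mem_richardson (hω : FormSymmetry τ ω) (he : IsIsotropicBasis ω e)
    (hP : IsSymbol (ambDim τ n) m P) (hT : IsSymbol (ambDim τ n) m T)
    {S : Submodule ℂ (Vec (ambDim τ n))} (hS : S ∈ richardson τ n ω e m P T)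
    {w : Vec (ambDim τ n)} (hw : w ∈ S) : SatisfiesEquations τ n m e P T w := by
  obtain ⟨σ, hσ0, hσ⟩ := hω.exists_sign
  obtain ⟨hSP, hSQ⟩ := richardson_subset hω he hS
  have hN : 2 * n ≤ ambDim τ n := by cases τ <;> simp only [ambDim] <;> omega
  refine ⟨fun c hc => ?_, fun c hc => ?_⟩
  · rcases hc with ⟨hcn, hc⟩ | ⟨hτ, rfl⟩
    · rw [quadForm_eq_partialForm (by omega)]
      rcases hc with hc | ⟨rfl, ⟨h, -⟩ | ⟨ht, d, hd, h⟩⟩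
      · exact partialForm_eq_zero_of_isApparentCut hσ he hSP hSQ hP hT (by omega) hc hw
      · omega
      · have h1 := hd.2.1
        -- Since c ≤ n, the reflected alternative N - d is impossible.
        obtain rfl : c = d := by omega
        exact (hd.isExceptionalPair hP hT ht).partialForm_eq_zero (hω.symm (by simp)) he rfl
          hSP hSQ hw
    · have h1 := two_mul_quadForm hω he hτ w
      rw [hSP.1.2 w hw w hw] at h1
      exact (mul_eq_zero.1 h1).resolve_left two_ne_zero
  · obtain ⟨h0, hcN, hc | ⟨j, -, hstar⟩⟩ := hc
    · exact coord_eq_zero_of_zeroColumn hSP hSQ hT h0 hcN (hc.cnt_le hP hT) hw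
    · have key : coord e (ambDim τ n + 1 - (ambDim τ n + 1 - c)) w = 0 := by
        by_cases happ : (ambDim τ n + 1 - c ∈ T ∧
            IsApparentCut (ambDim τ n) m P T (ambDim τ n + 1 - c)) ∨
            (ambDim τ n + 1 - c ∈ P ∧ IsApparentCut (ambDim τ n) m P T (ambDim τ n + 1 - c - 1))
        · exact coord_eq_zero_of_isApparentCut hσ0 hσ he hSP hSQ hP hT (by omega) (by omega)
            happ hw
        · have hex : τ = .D ∧ ((ambDim τ n + 1 - c ∈ T ∧
              IsExceptionalCut n m P T (ambDim τ n + 1 - c)) ∨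
              (ambDim τ n + 1 - c ∈ P ∧ IsExceptionalCut n m P T (ambDim τ n + 1 - c - 1))) := by
            simp only [cuts, Set.mem_ofPred_eq] at hstar
            tauto
          obtain ⟨rfl, hex⟩ := hex
          exact coord_eq_zero_of_isExceptionalCut (hω.symm (by simp)) he rfl hSP hSQ hP hT
            (by omega) (by omega) hex hw
      rwa [show ambDim τ n + 1 - (ambDim τ n + 1 - c) = c by omega] at key

end Main

end IsoGrass

open IsoGrass
theorem proposition5p2 (τ : LieType) (n m : ℕ) (hm : 1 ≤ m) (hmN : 2 * m ≤ ambDim τ n)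
    (ω : LinearMap.BilinForm ℂ (Vec (ambDim τ n))) (hω : FormSymmetry τ ω)
    (e : Module.Basis (Fin (ambDim τ n)) ℂ (Vec (ambDim τ n))) (he : IsIsotropicBasis ω e)
    (P T : Finset ℕ) (hP : IsSymbol (ambDim τ n) m P) (hT : IsSymbol (ambDim τ n) m T)
    (hTP : BruhatLE ω e m T P) :
    (∀ S ∈ richardson τ n ω e m P T, ∀ w ∈ S, SatisfiesEquations τ n m e P T w) ∧
    projected ω m (richardson τ n ω e m P T) ⊆ zVariety τ n m e P T ∧
    (τ = LieType.D → ∀ c, 1 ≤ c → c ≤ n → IsExceptionalCut n m P T c →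
      ∀ L ∈ projected ω m (openRichardson τ n ω e m P T), ∀ w ∈ L.submodule,
        quadForm τ n e c w = 0) := by
  have main : ∀ S ∈ richardson τ n ω e m P T, ∀ w ∈ S, SatisfiesEquations τ n m e P T w :=
    fun S hS w hw => satisfiesEquations_of_mem_richardson hω he hP hT hS hw
  refine ⟨main, ?_, ?_⟩
  · rintro _ ⟨⟨L, S⟩, ⟨⟨-, hL⟩, hS⟩, rfl⟩ w hw
    exact main S hS w (hL hw)
  · rintro hτ c - hcn hc _ ⟨⟨L, S⟩, ⟨⟨-, hL⟩, hS⟩, rfl⟩ w hw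
    exact (main S (openRichardson_subset hS) w (hL hw)).1 c (Or.inl ⟨hcn, Or.inr ⟨hτ, hc⟩⟩)
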